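/- Let $k$ be an algebraically closed field and let $n\ge 1$ be an integer that is nonzero in $k$. Let $\rho_1,\dots,\rho_r\in k$ be distinct, let $l_1,\dots,l_r$ be nonnegative integers with $n\mid \sum_i l_i$, and let $f(x)=\prod_{i=1}^r (x-\rho_i)^{l_i}$. Let $F=k(x)(y)$ be a field extension of $k(x)$ of degree $n$ with $y^n=f(x)$, and let $X$ be the smooth projective curve over $k$ with function field $F$, with the covering $\pi:X\to\mathbb P^1$ given by $x$. Put $U_0=X\setminus\pi^{-1}(0)$ and $U_\infty=X\setminus\pi^{-1}(\infty)$, and let $$H^1_{dR}(X/k)=\frac{\{(\omega_0,\omega_\infty,h)\in\Omega_X(U_0)\times\Omega_X(U_\infty)\times\mathcal O_X(U_0\cap U_\infty)\;:\; dh=\omega_0-\omega_\infty\}}{\{(dh_0,dh_\infty,h_0-h_\infty)\;:\; h_0\in\mathcal O_X(U_0),\ h_\infty\in\mathcal O_X(U_\infty)\}}$$ be the first de Rham cohomology in its Čech description for the covering $\{U_0,U_\infty\}$, where functions and differentials are regarded as rational functions and rational differentials on $X$. Put $g_i=\gcd(n,l_i)$, $e_i=n/g_i$, $\lambda_i=l_i/g_i$.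 For $1\le\mu\le n-1$ write $\mu\lambda_i=m_i^{(\mu)}e_i+\upsilon_i^{(\mu)}$ with $0\le\upsilon_i^{(\mu)}\le e_i-1$, and put $$g_\mu(x)=\prod_{i=1}^r (x-\rho_i)^{m_i^{(\mu)}},\qquad t^{(\mu)}=\frac1n\sum_{i=1}^r g_i\upsilon_i^{(\mu)}\in\mathbb Z,\qquad I^{(\mu)}=\{i:\upsilon_i^{(\mu)}\ne 0\},$$ $$\psi_{\mu,\nu}(x)=\sum_{i=1}^r g_i\upsilon_i^{(\mu)}\,x\prod_{j\in I^{(\mu)}\setminus\{i\}}(x-\rho_j)\;-\;\nu n\prod_{i\in I^{(\mu)}}(x-\rho_i).$$ For a polynomial $h$ and $s\in\mathbb N$ let $h^{\le s}$ and $h^{>s}$ be the sums of the monomials of $h$ of degree $\le s$ and $>s$. Consider all pairs $(\mu,\nu)$ with $1\le\mu\le n-1$, $t^{(\mu)}\ge2$ and $1\le\nu\le t^{(\mu)}-1$. For each such pair let $s=s_{\mu,\nu}$ be either $\nu$ or, if $t^{(n-\mu)}\ge 2$, possibly $\nu+1$ (an arbitrary choice for each pair). Then the triples $$\left(\frac{\psi_{\mu,\nu}^{\le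 s}(x)}{n x^{\nu+1}}\frac{g_{n-\mu}(x)}{y^{n-\mu}}\,dx,\ -\frac{\psi_{\mu,\nu}^{> s}(x)}{n x^{\nu+1}}\frac{g_{n-\mu}(x)}{y^{n-\mu}}\,dx,\ \frac{y^\mu}{x^\nu g_\mu(x)}\right)$$ and $$\left(\frac{x^{\nu-1}g_\mu(x)}{y^\mu}\,dx,\ \frac{x^{\nu-1}g_\mu(x)}{y^\mu}\,dx,\ 0\right)$$ belong to the numerator of the quotient above, and their classes $a_{\mu,\nu}$ and $\delta_{\mu,\nu}$, over all these pairs $(\mu,\nu)$, together form a $k$-basis of $H^1_{dR}(X/k)$. -/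

import Mathlib

open Polynomial
open scoped KaehlerDifferential

noncomputable section

namespace KummerCover

/-! ### Numerical data of the cover `y ^ n = ∏ i, (x - ρ i) ^ l i` -/

section Numerical

variable (n : ℕ) {r : ℕ} (l : Fin r → ℕ)

/-- `g_i = (n, l_i)`, the number of points above `ρ_i`. -/
def numPts (i : Fin r) : ℕ := Nat.gcd n (l i)

/-- `e_i = n / (n, l_i)`, the ramification index above `ρ_i`. -/
def ramIdx (i : Fin r) : ℕ := n / numPts n l i

/-- `λ_i = l_i / (l_i, n)`. -/
def lam (i : Fin r) : ℕ := l i / numPts n l i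

/-- `m_i^{(μ)}`, the quotient of `μ λ_i` by `e_i`. -/
def quo (μ : ℕ) (i : Fin r) : ℕ := μ * lam n l i / ramIdx n l i

/-- `υ_i^{(μ)}`, the remainder of `μ λ_i` modulo `e_i`. -/
def rem (μ : ℕ) (i : Fin r) : ℕ := μ * lam n l i % ramIdx n l i

/-- `t^{(μ)} = (1 / n) ∑ g_i υ_i^{(μ)}`. The division is exact when `n ∣ ∑ l_i`,
see `mul_tt`. -/
def tt (μ : ℕ) : ℕ := (∑ i, numPts n l i * rem n l μ i) / n

/-- `I^{(μ)}`, the set of `i` with `υ_i^{(μ)} ≠ 0`. -/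
def ramSet (μ : ℕ) : Finset (Fin r) := Finset.univ.filter fun i => rem n l μ i ≠ 0

/-- The division in the definition of `t^{(μ)}` is exact. -/
theorem mul_tt (hl : n ∣ ∑ i, l i) (μ : ℕ) :
    n * tt n l μ = ∑ i, numPts n l i * rem n l μ i := by
  refine Nat.mul_div_cancel' ?_
  have key : ∀ i, numPts n l i * rem n l μ i + n * quo n l μ i = μ * l i := by
    intro i
    have h1 : numPts n l i * ramIdx n l i = n := Nat.mul_div_cancel' (Nat.gcd_dvd_left _ _)
    have h2 : numPts n l i * lam n l i = l i := Nat.mul_div_cancel' (Nat.gcd_dvd_right _ _)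
    have h3 : rem n l μ i + ramIdx n l i * quo n l μ i = μ * lam n l i := Nat.mod_add_div _ _
    calc numPts n l i * rem n l μ i + n * quo n l μ i
        = numPts n l i * rem n l μ i + (numPts n l i * ramIdx n l i) * quo n l μ i := by rw [h1]
      _ = numPts n l i * (rem n l μ i + ramIdx n l i * quo n l μ i) := by ring
      _ = μ * (numPts n l i * lam n l i) := by rw [h3]; ring
      _ = μ * l i := by rw [h2]
  have hs : (∑ i, numPts n l i * rem n l μ i) + n * ∑ i, quo n l μ i = μ * ∑ i, l i := by
    rw [Finset.mul_sum, Finset.mul_sum, ← Finset.sum_add_distrib]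
    exact Finset.sum_congr rfl fun i _ => key i
  exact (Nat.dvd_add_left (Dvd.intro _ rfl)).1 (hs ▸ hl.mul_left μ)

/-- The pairs `(μ, ν)` with `1 ≤ μ ≤ n - 1`, `t^{(μ)} ≥ 2` and `1 ≤ ν ≤ t^{(μ)} - 1`. -/
def Idx : Type :=
  {q : ℕ × ℕ // (1 ≤ q.1 ∧ q.1 < n) ∧ 2 ≤ tt n l q.1 ∧ (1 ≤ q.2 ∧ q.2 < tt n l q.1)}

end Numerical

/-! ### The polynomials `f`, `g_μ`, `ψ_{μ,ν}` -/

section Polynomials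

variable {k : Type*} [Field k] (n : ℕ) {r : ℕ} (ρ : Fin r → k) (l : Fin r → ℕ)

/-- `f = ∏ (x - ρ_i) ^ {l_i}`. -/
def ff : k[X] := ∏ i, (X - C (ρ i)) ^ l i

/-- `g_μ = ∏ (x - ρ_i) ^ {m_i^{(μ)}}`. -/
def gg (μ : ℕ) : k[X] := ∏ i, (X - C (ρ i)) ^ quo n l μ i

/-- `ψ_{μ,ν} = ∑_i g_i υ_i^{(μ)} x ∏_{j ∈ I^{(μ)} \ {i}} (x - ρ_j)
  - ν n ∏_{i ∈ I^{(μ)}} (x - ρ_i)`. -/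
def psi (μ ν : ℕ) : k[X] :=
  (∑ i, C ((numPts n l i * rem n l μ i : ℕ) : k) * X *
      ∏ j ∈ (ramSet n l μ).erase i, (X - C (ρ j)))
    - C ((ν * n : ℕ) : k) * ∏ i ∈ ramSet n l μ, (X - C (ρ i))

/-- The sum of the monomials of `h` of degree `≤ m`. -/
def truncLE (h : k[X]) (m : ℕ) : k[X] := ∑ j ∈ h.support with j ≤ m, monomial j (h.coeff j)

/-- The sum of the monomials of `h` of degree `> m`. -/
def truncGT (h : k[X]) (m : ℕ) : k[X] := ∑ j ∈ h.support with m < j, monomial j (h.coeff j)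

end Polynomials

/-! ### The curve and its Čech de Rham cohomology

Let `F` be a function field of one variable over `k` and `x : F`. The curve `X` is the smooth
projective model of `F`, that is, the normalization of the projective line (with coordinate `x`)
in `F`. The preimage in `X` of an affine open set `Spec k[S]` of the line is the spectrum of the
integral closure of `k[S]` in `F`. The set `U_∞` is the preimage of `Spec k[x]`, the set `U_0`
is the preimage of `Spec k[1/x]`, and `U_0 ∩ U_∞` is the preimage of `Spec k[x, 1/x]`. -/

section DeRham

variable (k : Type*) {F : Type*} [Field k] [Field F] [Algebra k F]

/-- The regular functions on the preimage of `Spec k[S]`: the integral closure of `k[S]`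
in the function field. -/
def regFun (S : Set F) : Subalgebra k F :=
  (integralClosure (Algebra.adjoin k S) F).restrictScalars k

/-- The regular differentials on the preimage of `Spec k[S]`, as rational differentials: the image
in `Ω[F⁄k]` of the Kähler differentials of the ring of regular functions. -/
def regDiff (S : Set F) : Submodule k Ω[F⁄k] :=
  LinearMap.range ((KaehlerDifferential.map k k (regFun k S) F).restrictScalars k)

theorem regFun_mono {S T : Set F} (h : S ⊆ T) : regFun k S ≤ regFun k T := by
  intro a ha
  have ha' : IsIntegral (Algebra.adjoin k S) a := ha
  obtain ⟨p, hp, hpa⟩ := ha'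
  have hle : Algebra.adjoin k S ≤ Algebra.adjoin k T := Algebra.adjoin_mono h
  change IsIntegral (Algebra.adjoin k T) a
  refine ⟨p.map (Subalgebra.inclusion hle).toRingHom, hp.map _, ?_⟩
  rw [eval₂_map]
  exact hpa

theorem D_mem_regDiff {S : Set F} {a : F} (ha : a ∈ regFun k S) :
    KaehlerDifferential.D k F a ∈ regDiff k S :=
  ⟨KaehlerDifferential.D k (regFun k S) ⟨a, ha⟩, by
    simp [KaehlerDifferential.map_D]⟩

variable (x : F)

/-- `𝒪_X(U_0)`, where `U_0` is the complement of the fibre over `0`. -/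
def O0 : Subalgebra k F := regFun k {x⁻¹}

/-- `𝒪_X(U_∞)`, where `U_∞` is the complement of the fibre over `∞`. -/
def Oinf : Subalgebra k F := regFun k {x}

/-- `𝒪_X(U_0 ∩ U_∞)`. -/
def O0inf : Subalgebra k F := regFun k {x, x⁻¹}

/-- `Ω_X(U_0)`. -/
def Omega0 : Submodule k Ω[F⁄k] := regDiff k {x⁻¹}

/-- `Ω_X(U_∞)`. -/
def OmegaInf : Submodule k Ω[F⁄k] := regDiff k {x}

/-- The Čech de Rham 1-cocycles `(ω_0, ω_∞, f)` for the covering `U_0, U_∞`, with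
`df = ω_0 - ω_∞`. -/
def cocycles : Submodule k (Ω[F⁄k] × Ω[F⁄k] × F) where
  carrier := {w | w.1 ∈ Omega0 k x ∧ w.2.1 ∈ OmegaInf k x ∧ w.2.2 ∈ O0inf k x ∧
    KaehlerDifferential.D k F w.2.2 = w.1 - w.2.1}
  zero_mem' := ⟨zero_mem _, zero_mem _, zero_mem _, by simp⟩
  add_mem' := by
    rintro u v ⟨h1, h2, h3, h4⟩ ⟨h1', h2', h3', h4'⟩
    refine ⟨add_mem h1 h1', add_mem h2 h2', add_mem h3 h3', ?_⟩
    simp only [Prod.fst_add, Prod.snd_add, map_add, h4, h4']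
    abel
  smul_mem' := by
    rintro c u ⟨h1, h2, h3, h4⟩
    refine ⟨Submodule.smul_mem _ c h1, Submodule.smul_mem _ c h2,
      Subalgebra.smul_mem _ h3 c, ?_⟩
    simp only [Prod.smul_fst, Prod.smul_snd, Derivation.map_smul, h4, smul_sub]

/-- The Čech de Rham 1-coboundaries `(df_0, df_∞, f_0 - f_∞)`. -/
def coboundaries : Submodule k (Ω[F⁄k] × Ω[F⁄k] × F) where
  carrier := {w | ∃ f₀ ∈ O0 k x, ∃ f₁ ∈ Oinf k x,
    w = (KaehlerDifferential.D k F f₀, KaehlerDifferential.D k F f₁, f₀ - f₁)}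
  zero_mem' := ⟨0, zero_mem _, 0, zero_mem _, by simp only [map_zero, sub_zero]; rfl⟩
  add_mem' := by
    rintro _ _ ⟨a, ha, b, hb, rfl⟩ ⟨a', ha', b', hb', rfl⟩
    refine ⟨a + a', add_mem ha ha', b + b', add_mem hb hb', ?_⟩
    simp only [Prod.mk_add_mk, map_add, add_sub_add_comm]
  smul_mem' := by
    rintro c _ ⟨a, ha, b, hb, rfl⟩
    refine ⟨c • a, Subalgebra.smul_mem _ ha c, c • b, Subalgebra.smul_mem _ hb c, ?_⟩
    simp only [Prod.smul_mk, Derivation.map_smul, smul_sub]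

theorem coboundaries_le_cocycles : coboundaries k x ≤ cocycles k x := by
  rintro _ ⟨a, ha, b, hb, rfl⟩
  refine ⟨D_mem_regDiff k ha, D_mem_regDiff k hb, sub_mem ?_ ?_, map_sub _ _ _⟩
  · exact regFun_mono k (by simp) ha
  · exact regFun_mono k (by simp) hb

/-- `H¹_dR(X/k)`, cocycles modulo coboundaries. -/
abbrev H1dR : Type _ := cocycles k x ⧸ (coboundaries k x).submoduleOf (cocycles k x)

/-- The class of a cocycle in `H¹_dR(X/k)`. -/
def cls (w : Ω[F⁄k] × Ω[F⁄k] × F) (hw : w ∈ cocycles k x) : H1dR k x :=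
  Submodule.Quotient.mk ⟨w, hw⟩

end DeRham

/-! ### The explicit triples -/

section Triples

variable {k F : Type*} [Field k] [Field F] [Algebra k F]
  (n : ℕ) {r : ℕ} (ρ : Fin r → k) (l : Fin r → ℕ) (x y : F)

/-- The rational differential `(g_μ(x) / y ^ μ) dx`. -/
def omegaOne (μ : ℕ) : Ω[F⁄k] :=
  (aeval x (gg n ρ l μ) / y ^ μ) • KaehlerDifferential.D k F x

/-- The triple `(x^{ν-1} g_μ / y^μ dx, x^{ν-1} g_μ / y^μ dx, 0)`. -/
def deltaTriple (μ ν : ℕ) : Ω[F⁄k] × Ω[F⁄k] × F :=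
  (x ^ (ν - 1) • omegaOne n ρ l x y μ, x ^ (ν - 1) • omegaOne n ρ l x y μ, 0)

/-- The triple with entries
`(ψ^{≤ s} / (n x^{ν+1})) (g_{n-μ} / y^{n-μ}) dx`,
`- (ψ^{> s} / (n x^{ν+1})) (g_{n-μ} / y^{n-μ}) dx` and `y^μ / (x^ν g_μ)`,
where `ψ = ψ_{μ,ν}`, cut at degree `s`. -/
def aTriple (μ ν s : ℕ) : Ω[F⁄k] × Ω[F⁄k] × F :=
  ((aeval x (truncLE (psi n ρ l μ ν) s) / ((n : F) * x ^ (ν + 1))) • omegaOne n ρ l x y (n - μ),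
    -((aeval x (truncGT (psi n ρ l μ ν) s) / ((n : F) * x ^ (ν + 1))) •
      omegaOne n ρ l x y (n - μ)),
    y ^ μ / (x ^ ν * aeval x (gg n ρ l μ)))

end Triples

end KummerCover

end

/-!
Put `w_μ = y ^ μ / g_μ(x)`. It depends only on `μ` modulo `n`, and `w_μ ^ n` is a polynomial in `x`
all of whose roots have multiplicity less than `n`. Averaging over the conjugates `y ↦ ζ y` splits
an integral element into integral eigencomponents, so the integral closure of `k[x]` is
`⨁ k[x] w_μ`. The differentials regular on `U_∞` are `⨁ k[x] w_μ⁻¹ dx`. They lie in this sum because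
`d w_μ` is a polynomial multiple of `w_{-μ}⁻¹ dx`. Conversely, the polynomials `p` for which
`p(x) w_κ⁻¹ dx` is regular form an ideal which contains `∏_{i ∈ I^{(κ)}} (x - ρ_i)` and, for each
such `i`, a polynomial not vanishing at `ρ_i`, coming from `w_ν d w_μ` with `υ_i^{(μ)} = 1` and
`μ + ν + κ ≡ 0` modulo `n`.

The substitution `x ↦ 1/x` multiplies `w_μ` by `x ^ (-t^{(μ)})`. In terms of the linearly
independent `x ^ m w_μ` and `x ^ m w_μ⁻¹ dx`, functions and differentials on `U_∞` are therefore
given by `0 ≤ m`, and those on `U_0` by `m ≤ -t^{(μ)}` and `m ≤ t^{(μ)} - 2`. Hence the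
`x ^ (-ν) w_μ` with `0 < ν < t^{(μ)}` represent a basis of `H¹(X, 𝒪)`, and the
`x ^ (ν - 1) w_μ⁻¹ dx` form a basis of `H⁰(X, Ω)`. In
`d (x ^ (-ν) w_μ) = ψ_{μ,ν}(x) / (n x ^ (ν + 1)) w_{n-μ}⁻¹ dx` the monomials of `ψ_{μ,ν}` of degree
less than `ν + t^{(n-μ)}` are regular on `U_0` and those of degree greater than `ν` are regular on
`U_∞`. Cutting at `s` in between lifts the basis of `H¹(X, 𝒪)` along
`0 → H⁰(X, Ω) → H¹_dR(X/k) → H¹(X, 𝒪)`.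
-/

noncomputable section

namespace KummerCover

open scoped IntermediateField
open KaehlerDifferential (D)

/-! ### Carries of the exponents -/

section Numerical

variable {n r : ℕ} (l : Fin r → ℕ)

theorem numPts_mul_ramIdx (i : Fin r) : numPts n l i * ramIdx n l i = n :=
  Nat.mul_div_cancel' (Nat.gcd_dvd_left _ _)

theorem numPts_mul_lam (i : Fin r) : numPts n l i * lam n l i = l i :=
  Nat.mul_div_cancel' (Nat.gcd_dvd_right _ _)

theorem rem_add_ramIdx_mul_quo (μ : ℕ) (i : Fin r) :
    rem n l μ i + ramIdx n l i * quo n l μ i = μ * lam n l i :=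
  Nat.mod_add_div _ _

theorem numPts_mul_rem_add_mul_quo (μ : ℕ) (i : Fin r) :
    numPts n l i * rem n l μ i + n * quo n l μ i = μ * l i := by
  linear_combination numPts n l i * rem_add_ramIdx_mul_quo (n := n) l μ i +
    μ * numPts_mul_lam (n := n) l i - quo n l μ i * numPts_mul_ramIdx (n := n) l i

theorem quo_zero : quo n l 0 = 0 := by
  ext i
  simp [quo]

theorem rem_zero (i : Fin r) : rem n l 0 i = 0 := by
  simp [rem]

theorem add_mul_mul_lam (μ c : ℕ) (i : Fin r) :
    (μ + n * c) * lam n l i = μ * lam n l i + c * l i * ramIdx n l i := by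
  linear_combination c * ramIdx n l i * numPts_mul_lam (n := n) l i -
    c * lam n l i * numPts_mul_ramIdx (n := n) l i

theorem rem_add_mul (μ c : ℕ) (i : Fin r) : rem n l (μ + n * c) i = rem n l μ i := by
  rw [rem, add_mul_mul_lam, Nat.add_mul_mod_self_right, rem]

theorem rem_eq_zero_of_dvd {μ : ℕ} (h : n ∣ μ) (i : Fin r) : rem n l μ i = 0 := by
  obtain ⟨c, rfl⟩ := h
  rw [← zero_add (n * c), rem_add_mul, rem_zero]

theorem tt_zero : tt n l 0 = 0 := by
  simp [tt, rem_zero]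

/-- The exponent of the factor `P_i` in the quotient `w_μ w_ν / w_{μ+ν}` of the functions
`w_μ = y ^ μ / ∏ P_i ^ {m_i^{(μ)}}`, see `kummerFun`. -/
def carry (n : ℕ) {r : ℕ} (l : Fin r → ℕ) (μ ν : ℕ) (i : Fin r) : ℕ :=
  quo n l (μ + ν) i - quo n l μ i - quo n l ν i

theorem quo_add (μ ν : ℕ) : quo n l (μ + ν) = quo n l μ + quo n l ν + carry n l μ ν := by
  ext i
  have superadditive : quo n l μ i + quo n l ν i ≤ quo n l (μ + ν) i := by
    simp only [quo, add_mul]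
    exact Nat.div_add_div_le_add_div
  simp only [Pi.add_apply, carry]
  lia

theorem rem_add_rem (μ ν : ℕ) (i : Fin r) :
    rem n l μ i + rem n l ν i = rem n l (μ + ν) i + ramIdx n l i * carry n l μ ν i := by
  have hquo := congrFun (quo_add (n := n) l μ ν) i
  simp only [Pi.add_apply] at hquo
  zify at hquo ⊢
  have hμ := rem_add_ramIdx_mul_quo (n := n) l μ i
  have hν := rem_add_ramIdx_mul_quo (n := n) l ν i
  have hadd := rem_add_ramIdx_mul_quo (n := n) l (μ + ν) i
  zify at hμ hν hadd
  linear_combination hμ + hν - hadd + ramIdx n l i * hquo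

theorem carry_eq_zero {μ ν : ℕ} {i : Fin r} (h : rem n l μ i + rem n l ν i < ramIdx n l i) :
    carry n l μ ν i = 0 := by
  by_contra hc
  have := rem_add_rem (n := n) l μ ν i
  have := Nat.le_mul_of_pos_right (ramIdx n l i) (Nat.pos_of_ne_zero hc)
  lia

section NeZero

variable [NeZero n]

theorem exists_dvd_add (μ : ℕ) : ∃ ν, n ∣ μ + ν :=
  ⟨(n - 1) * μ, μ, by rw [← one_add_mul, Nat.add_sub_cancel' NeZero.one_le]⟩

theorem numPts_pos (i : Fin r) : 0 < numPts n l i :=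
  Nat.gcd_pos_of_pos_left _ (NeZero.pos n)

theorem ramIdx_pos (i : Fin r) : 0 < ramIdx n l i :=
  Nat.pos_of_ne_zero fun h => NeZero.ne n (by rw [← numPts_mul_ramIdx (n := n) l i, h, mul_zero])

theorem rem_lt (μ : ℕ) (i : Fin r) : rem n l μ i < ramIdx n l i :=
  Nat.mod_lt _ (ramIdx_pos l i)

theorem numPts_mul_rem_lt (μ : ℕ) (i : Fin r) : numPts n l i * rem n l μ i < n :=
  (Nat.mul_lt_mul_of_pos_left (rem_lt l μ i) (numPts_pos l i)).trans_eq (numPts_mul_ramIdx l i)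

theorem quo_add_mul (μ c : ℕ) : quo n l (μ + n * c) = quo n l μ + c • l := by
  ext i
  rw [quo, add_mul_mul_lam, Nat.add_mul_div_right _ _ (ramIdx_pos l i)]
  rfl

theorem exists_rem_eq_one {i : Fin r} (h : 2 ≤ ramIdx n l i) : ∃ μ, rem n l μ i = 1 := by
  have hcop : (lam n l i).Coprime (ramIdx n l i) :=
    (Nat.coprime_div_gcd_div_gcd (numPts_pos l i)).symm
  obtain ⟨μ, -, hμ⟩ := Nat.exists_mul_mod_eq_one_of_coprime hcop h
  exact ⟨μ, by rw [rem, mul_comm, hμ]⟩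

variable {μ ν : ℕ} (hdvd : n ∣ μ + ν)
include hdvd

theorem rem_add_rem_of_dvd {i : Fin r} (hi : rem n l μ i ≠ 0) :
    rem n l μ i + rem n l ν i = ramIdx n l i := by
  have hsum := rem_add_rem (n := n) l μ ν i
  rw [rem_eq_zero_of_dvd l hdvd, zero_add] at hsum
  have hμ := rem_lt (n := n) l μ i
  have hν := rem_lt (n := n) l ν i
  have hpos : carry n l μ ν i ≠ 0 := fun h => by rw [h, mul_zero] at hsum; lia
  have hlt : carry n l μ ν i < 2 := by
    by_contra! h
    have := Nat.mul_le_mul_left (ramIdx n l i) h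
    lia
  rw [hsum, show carry n l μ ν i = 1 by lia, mul_one]

theorem carry_of_dvd (i : Fin r) : carry n l μ ν i = if i ∈ ramSet n l μ then 1 else 0 := by
  have hsum := rem_add_rem (n := n) l μ ν i
  rw [rem_eq_zero_of_dvd l hdvd, zero_add] at hsum
  simp only [ramSet, Finset.mem_filter, Finset.mem_univ, true_and]
  split_ifs with hi
  · rw [rem_add_rem_of_dvd l hdvd hi] at hsum
    exact Nat.eq_of_mul_eq_mul_left (ramIdx_pos l i) (by rw [← hsum, mul_one])
  · refine carry_eq_zero l ?_
    rw [not_not.1 hi, zero_add]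
    exact rem_lt l ν i

theorem tt_ne_zero_of_dvd (hl : n ∣ ∑ i, l i) (hμ : tt n l μ ≠ 0) : tt n l ν ≠ 0 := by
  have hsum : ∑ i, numPts n l i * rem n l μ i ≠ 0 := by
    rw [← mul_tt n l hl]
    exact mul_ne_zero (NeZero.ne n) hμ
  obtain ⟨i, -, hi⟩ := Finset.exists_ne_zero_of_sum_ne_zero hsum
  have hadd := rem_add_rem_of_dvd l hdvd (right_ne_zero_of_mul hi)
  have hterm : numPts n l i * rem n l ν i ≠ 0 :=
    mul_ne_zero (numPts_pos l i).ne' fun h => by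
      have := rem_lt (n := n) l μ i
      lia
  intro h0
  have hsum' := mul_tt n l hl ν
  rw [h0, mul_zero, eq_comm, Finset.sum_eq_zero_iff] at hsum'
  exact hterm (hsum' i (Finset.mem_univ i))

end NeZero

theorem carry_eq_zero_of_rem_eq_one [NeZero n] {μ ν κ : ℕ} {i : Fin r} (h : n ∣ μ + (ν + κ))
    (hμ : rem n l μ i = 1) : carry n l ν κ i = 0 := by
  have hadd := rem_add_rem_of_dvd l h (hμ ▸ one_ne_zero)
  by_contra hc
  have hsum := rem_add_rem (n := n) l ν κ i
  have hν := rem_lt (n := n) l ν i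
  have hκ := rem_lt (n := n) l κ i
  have hmul := Nat.le_mul_of_pos_right (ramIdx n l i) (Nat.pos_of_ne_zero hc)
  lia

theorem tt_eq_mul_sub_sum_quo [NeZero n] {L : ℕ} (hL : ∑ i, l i = n * L) (μ : ℕ) :
    (tt n l μ : ℤ) = μ * L - ∑ i, (quo n l μ i : ℤ) := by
  have hmul : (n : ℤ) * (tt n l μ + ∑ i, (quo n l μ i : ℤ)) = n * (μ * L) := by
    have hsum := mul_tt n l ⟨L, hL⟩ μ
    zify at hsum hL
    rw [mul_add, hsum, Finset.mul_sum, ← Finset.sum_add_distrib, mul_left_comm, ← hL,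
      Finset.mul_sum]
    exact Finset.sum_congr rfl fun i _ => mod_cast numPts_mul_rem_add_mul_quo l μ i
  exact eq_sub_of_add_eq (mul_left_cancel₀ (NeZero.ne (n : ℤ)) hmul)

end Numerical

section Polynomials

variable {k : Type*} [Field k] {r : ℕ} (P : Fin r → k[X])

/-- The product `∏ P_i ^ {a_i}`. For `P_i = X - ρ_i` these are the polynomials `f` and `g_μ`; for
`P_i = 1 - ρ_i X` they are their counterparts in the coordinate `1/x`. -/
def prodPow (a : Fin r → ℕ) : k[X] := ∏ i, P i ^ a i

theorem prodPow_zero : prodPow P 0 = 1 := by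
  simp [prodPow]

theorem prodPow_add (a b : Fin r → ℕ) : prodPow P (a + b) = prodPow P a * prodPow P b := by
  simp [prodPow, pow_add, Finset.prod_mul_distrib]

theorem prodPow_nsmul (c : ℕ) (a : Fin r → ℕ) : prodPow P (c • a) = prodPow P a ^ c := by
  simp [prodPow, pow_mul', Finset.prod_pow]

theorem prodPow_dvd_prodPow {a b : Fin r → ℕ} (h : a ≤ b) : prodPow P a ∣ prodPow P b :=
  Finset.prod_dvd_prod_of_dvd _ _ fun i _ => pow_dvd_pow _ (h i)

theorem prodPow_ne_zero {P : Fin r → k[X]} (hP : ∀ i, P i ≠ 0) (a : Fin r → ℕ) :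
    prodPow P a ≠ 0 :=
  Finset.prod_ne_zero_iff.2 fun i _ => pow_ne_zero _ (hP i)

theorem isCoprime_prodPow {P : Fin r → k[X]} {i : Fin r}
    (hcop : Pairwise (Function.onFun IsCoprime P)) {a : Fin r → ℕ} (ha : a i = 0) :
    IsCoprime (prodPow P a) (P i) := by
  refine IsCoprime.prod_left fun j _ => ?_
  rcases eq_or_ne j i with rfl | hj
  · rw [ha, pow_zero]
    exact isCoprime_one_left
  · exact (hcop hj).pow_left

/-- The branch polynomial `∏_{i ∈ I^{(μ)}} P_i` of the function `w_μ`, see `kummerFun`. -/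
def ramPoly (n : ℕ) (P : Fin r → k[X]) (l : Fin r → ℕ) (μ : ℕ) : k[X] := ∏ i ∈ ramSet n l μ, P i

/-- The polynomial `∑ g_i υ_i^{(μ)} P_i' ∏_{j ∈ I^{(μ)} \ {i}} P_j`, that is, `ramPoly` times the
logarithmic derivative of `∏ P_i ^ {g_i υ_i^{(μ)}}`. -/
def dlogPoly (n : ℕ) (P : Fin r → k[X]) (l : Fin r → ℕ) (μ : ℕ) : k[X] :=
  ∑ i, C ((numPts n l i * rem n l μ i : ℕ) : k) * derivative (P i) *
    ∏ j ∈ (ramSet n l μ).erase i, P j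

variable (l : Fin r → ℕ) {n μ : ℕ}

theorem prodPow_carry_of_dvd [NeZero n] {ν : ℕ} (h : n ∣ μ + ν) :
    prodPow P (carry n l μ ν) = ramPoly n P l μ := by
  simp only [prodPow, carry_of_dvd l h, pow_ite, pow_one, pow_zero, Finset.prod_ite_mem,
    Finset.univ_inter, ramPoly]

theorem derivative_prodPow_mul_ramPoly :
    derivative (prodPow P fun i => numPts n l i * rem n l μ i) * ramPoly n P l μ =
      (prodPow P fun i => numPts n l i * rem n l μ i) * dlogPoly n P l μ := by
  rw [prodPow, derivative_prod_finset, dlogPoly, Finset.sum_mul, Finset.mul_sum]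
  refine Finset.sum_congr rfl fun i _ => ?_
  rcases h : numPts n l i * rem n l μ i with _ | a
  · simp
  have hi : i ∈ ramSet n l μ := by
    have : rem n l μ i ≠ 0 := fun h0 => by simp [h0] at h
    simpa [ramSet] using this
  rw [ramPoly, ← Finset.mul_prod_erase _ _ hi, ← Finset.prod_erase_mul _ _ (Finset.mem_univ i), h,
    derivative_pow_succ, pow_succ]
  push_cast
  ring

theorem isCoprime_dlogPoly {P : Fin r → k[X]} {i : Fin r} (hsep : (P i).Separable)
    (hcop : Pairwise (Function.onFun IsCoprime P)) (hn : (n : k) ≠ 0) (hi : rem n l μ i = 1) :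
    IsCoprime (dlogPoly n P l μ) (P i) := by
  have hmem : i ∈ ramSet n l μ := by simp [ramSet, hi]
  have hdvd : P i ∣ ∑ j ∈ Finset.univ.erase i, C ((numPts n l j * rem n l μ j : ℕ) : k) *
      derivative (P j) * ∏ j' ∈ (ramSet n l μ).erase j, P j' :=
    Finset.dvd_sum fun j hj => (Finset.dvd_prod_of_mem P
      (Finset.mem_erase.2 ⟨(Finset.ne_of_mem_erase hj).symm, hmem⟩)).mul_left _
  obtain ⟨t, ht⟩ := hdvd
  rw [dlogPoly, ← Finset.add_sum_erase _ _ (Finset.mem_univ i), ht, hi, mul_one]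
  have hg : (numPts n l i : k) ≠ 0 := fun h0 => hn <| by
    rw [← numPts_mul_ramIdx (n := n) l i, Nat.cast_mul, h0, zero_mul]
  refine (IsCoprime.mul_left (IsCoprime.mul_left ?_ (IsCoprime.symm hsep))
    (IsCoprime.prod_left fun j hj => hcop (Finset.ne_of_mem_erase hj))).add_mul_left_left t
  exact (isCoprime_one_left (R := k[X])).of_isCoprime_of_dvd_left (isUnit_C.2 hg.isUnit).dvd

end Polynomials

theorem eq_top_of_prod_mem_of_exists_isCoprime {R ι : Type*} [CommRing R] {N : Ideal R}
    {s : Finset ι} {p : ι → R} (hprod : ∏ i ∈ s, p i ∈ N)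
    (hcop : ∀ i ∈ s, ∃ q ∈ N, IsCoprime q (p i)) : N = ⊤ := by
  by_contra hN
  obtain ⟨m, hm, hNm⟩ := N.exists_le_maximal hN
  obtain ⟨i, hi, him⟩ := hm.isPrime.prod_mem_iff.1 (hNm hprod)
  obtain ⟨q, hq, a, b, hab⟩ := hcop i hi
  exact hm.ne_top ((Ideal.eq_top_iff_one _).2
    (hab ▸ add_mem (m.mul_mem_left a (hNm hq)) (m.mul_mem_left b him)))

theorem isUnit_of_pow_succ_dvd_pow_of_squarefree {R : Type*} [CommRing R] [IsDomain R]
    [UniqueFactorizationMonoid R] {s q : R} (hs : Squarefree s) {m : ℕ} (h : q ^ (m + 1) ∣ s ^ m) :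
    IsUnit q := by
  by_contra hq
  have hq0 : q ≠ 0 := by
    rintro rfl
    rw [zero_pow m.succ_ne_zero, zero_dvd_iff] at h
    exact hs.ne_zero (eq_zero_of_pow_eq_zero h)
  obtain ⟨p, hp, hpq⟩ := WfDvdMonoid.exists_irreducible_factor hq hq0
  have hp' : Prime p := hp.prime
  replace h : p ^ (m + 1) ∣ s ^ m := (pow_dvd_pow_of_dvd hpq _).trans h
  obtain ⟨t, rfl⟩ : p ∣ s := hp'.dvd_of_dvd_pow ((dvd_pow_self p m.succ_ne_zero).trans h)
  rw [pow_succ, mul_pow, mul_dvd_mul_iff_left (pow_ne_zero m hp'.ne_zero)] at h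
  exact hp.not_isUnit (hs p (mul_dvd_mul_left p (hp'.dvd_of_dvd_pow h)))

theorem isInteger_of_isIntegral_pow_mul {A K : Type*} [CommRing A] [IsDomain A]
    [UniqueFactorizationMonoid A] [Field K] [Algebra A K] [IsFractionRing A K] {n : ℕ} {d : A}
    (hd : ∀ q : A, q ^ n ∣ d → IsUnit q) {c : K} (hc : IsIntegral A (c ^ n * algebraMap A K d)) :
    IsLocalization.IsInteger A c := by
  obtain ⟨a, ha⟩ := IsIntegrallyClosed.isIntegral_iff.1 hc
  refine IsFractionRing.isInteger_of_isUnit_den (hd _ ?_)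
  have hden : algebraMap A K (IsFractionRing.den A c) ≠ 0 := by simp
  have hmul : IsFractionRing.num A c ^ n * d = (IsFractionRing.den A c : A) ^ n * a := by
    apply IsFractionRing.injective A K
    rw [map_mul, map_mul, map_pow, map_pow, ha, ← mul_assoc, ← mul_pow, mul_comm _ c]
    rw [(div_eq_iff hden).1 (IsFractionRing.mk'_num_den' A c)]
  exact (IsFractionRing.num_den_reduced A c).symm.pow.dvd_of_dvd_mul_left
    (Dvd.intro a hmul.symm)

/-! ### Eigencomponents of integral elements -/

section Components

variable {K F : Type*} [Field K] [Field F] [Algebra K F] {n : ℕ} [NeZero n] {y : F}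

theorem linearIndependent_pow_of_adjoin_eq_top (hy : K⟮y⟯ = ⊤) (hdeg : Module.finrank K F = n) :
    LinearIndependent K fun j : Fin n => y ^ (j : ℕ) := by
  have : FiniteDimensional K F := .of_finrank_pos (hdeg ▸ NeZero.pos n)
  rw [Field.primitive_element_iff_minpoly_natDegree_eq, hdeg] at hy
  subst hy
  exact linearIndependent_pow y

theorem minpoly_eq_X_pow_sub_C (hy : K⟮y⟯ = ⊤) (hdeg : Module.finrank K F = n) {a : K}
    (ha : y ^ n = algebraMap K F a) : minpoly K y = X ^ n - C a := by
  have : FiniteDimensional K F := .of_finrank_pos (hdeg ▸ NeZero.pos n)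
  rw [Field.primitive_element_iff_minpoly_natDegree_eq, hdeg] at hy
  refine (eq_of_monic_of_dvd_of_natDegree_le (minpoly.monic (.of_finite K y))
    (monic_X_pow_sub_C a (NeZero.ne n)) (minpoly.dvd K y ?_) ?_).symm
  · simp [ha]
  · rw [natDegree_X_pow_sub_C, hy]

theorem exists_algHom_apply_eq_mul (hy : K⟮y⟯ = ⊤) (hdeg : Module.finrank K F = n) {a : K}
    (ha : y ^ n = algebraMap K F a) {E : Type*} [Field E] [IsAlgClosed E] [Algebra K E]
    [Algebra F E] [IsScalarTower K F E] {ζ : E} (hζ : ζ ^ n = 1) :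
    ∃ σ : F →ₐ[K] E, σ y = ζ * algebraMap F E y := by
  have : FiniteDimensional K F := .of_finrank_pos (hdeg ▸ NeZero.pos n)
  refine IntermediateField.exists_algHom_of_adjoin_splits_of_aeval
    (fun s _ => ⟨.of_finite K s, IsAlgClosed.splits _⟩) hy ?_
  rw [minpoly_eq_X_pow_sub_C hy hdeg ha, map_sub, map_pow, aeval_X, aeval_C, mul_pow, hζ, one_mul,
    ← map_pow, ha, ← IsScalarTower.algebraMap_apply, sub_self]

theorem sum_range_inv_pow_mul_pow {E : Type*} [Field E] {ζ : E} (hζ : IsPrimitiveRoot ζ n)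
    (i j : Fin n) : ∑ m ∈ Finset.range n, (ζ ^ m)⁻¹ ^ (j : ℕ) * (ζ ^ m) ^ (i : ℕ) =
      if i = j then (n : E) else 0 := by
  have hζ0 : ζ ≠ 0 := hζ.ne_zero (NeZero.ne n)
  have hpow (m : ℕ) :
      (ζ ^ m)⁻¹ ^ (j : ℕ) * (ζ ^ m) ^ (i : ℕ) = ((ζ ^ (j : ℕ))⁻¹ * ζ ^ (i : ℕ)) ^ m := by
    rw [mul_pow, inv_pow, inv_pow, ← pow_mul, ← pow_mul, ← pow_mul, ← pow_mul, mul_comm m,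
      mul_comm m]
  simp only [hpow]
  split_ifs with h
  · simp [h, hζ0]
  · rw [geom_sum_eq, mul_pow, inv_pow, ← pow_mul, ← pow_mul, mul_comm (j : ℕ), mul_comm (i : ℕ),
      pow_mul, pow_mul, hζ.pow_eq_one]
    · simp
    · rw [Ne, inv_mul_eq_one₀ (pow_ne_zero _ hζ0)]
      exact fun hij => h (Fin.ext (hζ.pow_inj j.2 i.2 hij).symm)

/-- The discrete Fourier transform over the conjugates of `∑ c_i y ^ i` isolates the component of
weight `j`. -/
theorem algebraMap_nsmul_component {E : Type*} [Field E] [Algebra K E] [Algebra F E]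
    [IsScalarTower K F E] {ζ : E} (hζ : IsPrimitiveRoot ζ n) {σ : ℕ → F →ₐ[K] E}
    (hσ : ∀ m, σ m y = ζ ^ m * algebraMap F E y) (c : Fin n → K) (j : Fin n) :
    algebraMap F E (n • c j • y ^ (j : ℕ)) =
      ∑ m ∈ Finset.range n, (ζ ^ m)⁻¹ ^ (j : ℕ) * σ m (∑ i, c i • y ^ (i : ℕ)) := by
  have hterm (m : ℕ) (i : Fin n) : (ζ ^ m)⁻¹ ^ (j : ℕ) * σ m (c i • y ^ (i : ℕ)) =
      (ζ ^ m)⁻¹ ^ (j : ℕ) * (ζ ^ m) ^ (i : ℕ) * algebraMap F E (c i • y ^ (i : ℕ)) := by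
    simp only [map_pow, hσ, mul_pow, Algebra.smul_def, map_mul, AlgHom.commutes,
      ← IsScalarTower.algebraMap_apply]
    ring
  simp only [map_sum, Finset.mul_sum, hterm]
  rw [Finset.sum_comm]
  simp only [← Finset.sum_mul, sum_range_inv_pow_mul_pow hζ, ite_mul, zero_mul, Finset.sum_ite_eq',
    Finset.mem_univ, if_true, nsmul_eq_mul, map_mul, map_natCast]

theorem isIntegral_component {R : Type*} [CommRing R] [Algebra R K] [Algebra R F]
    [IsScalarTower R K F] (hn : IsUnit (n : R)) (hy : K⟮y⟯ = ⊤) (hdeg : Module.finrank K F = n)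
    {a : K} (ha : y ^ n = algebraMap K F a) {c : Fin n → K}
    (hb : IsIntegral R (∑ j, c j • y ^ (j : ℕ))) (j : Fin n) :
    IsIntegral R (c j • y ^ (j : ℕ)) := by
  have : NeZero (n : AlgebraicClosure F) :=
    ⟨by simpa using (hn.map (algebraMap R (AlgebraicClosure F))).ne_zero⟩
  obtain ⟨ζ, hζ⟩ := HasEnoughRootsOfUnity.exists_primitiveRoot (AlgebraicClosure F) n
  have hroot (m : ℕ) : (ζ ^ m) ^ n = 1 := by rw [pow_right_comm, hζ.pow_eq_one, one_pow]
  choose σ hσ using fun m : ℕ => exists_algHom_apply_eq_mul hy hdeg ha (hroot m)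
  have hint : IsIntegral R (n • c j • y ^ (j : ℕ)) := by
    rw [← isIntegral_algebraMap_iff (algebraMap F (AlgebraicClosure F)).injective,
      algebraMap_nsmul_component hζ hσ]
    refine IsIntegral.sum _ fun m _ => IsIntegral.mul (.pow (.of_pow (NeZero.pos n) ?_) _)
      (hb.map ((σ m).restrictScalars R))
    rw [inv_pow, hroot, inv_one]
    exact isIntegral_one
  obtain ⟨u, hu⟩ := hn.exists_left_inv
  have := hint.smul u
  rwa [← Nat.cast_smul_eq_nsmul R, smul_smul, hu, one_smul] at this

end Components

/-! ### Kummer covers -/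

section KummerCover

variable {k F : Type*} [Field k] [Field F] [Algebra k F] {n r : ℕ} {P : Fin r → k[X]}
  {l : Fin r → ℕ} {x y : F}

/-- The field `F` is a Kummer extension of degree `n` of the rational function field `k(x)`,
generated by `y` with `y ^ n = ∏ P_i(x) ^ {l_i}` for separable and pairwise coprime polynomials
`P_i`. Allowing arbitrary `P_i` makes the notion symmetric under `x ↦ 1/x`, see
`IsKummerCover.inv`. -/
structure IsKummerCover (n : ℕ) (P : Fin r → k[X]) (l : Fin r → ℕ) (x y : F) : Prop where
  natCast_ne_zero : (n : k) ≠ 0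
  separable (i : Fin r) : (P i).Separable
  pairwise_isCoprime : Pairwise (Function.onFun IsCoprime P)
  transcendental : Transcendental k x
  pow_eq : y ^ n = aeval x (prodPow P l)
  adjoin_eq_top : k⟮x, y⟯ = ⊤
  finrank_eq : Module.finrank k⟮x⟯ F = n

variable (n P l x y) in
/-- The function `w_μ = y ^ μ / ∏ P_i(x) ^ {m_i^{(μ)}}`. The `w_μ` with `μ < n` generate the
integral closure of `k[x]` in `F`. -/
def kummerFun (μ : ℕ) : F := y ^ μ / aeval x (prodPow P (quo n l μ))

variable (n P l x y) in
/-- The differential `w_μ⁻¹ dx`. -/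
def kummerDiff (μ : ℕ) : Ω[F⁄k] := (kummerFun n P l x y μ)⁻¹ • D k F x

theorem kummerFun_zero : kummerFun n P l x y 0 = 1 := by
  simp [kummerFun, quo_zero, prodPow_zero]

namespace IsKummerCover

variable (H : IsKummerCover n P l x y)
include H

theorem neZero : NeZero n :=
  ⟨fun h => H.natCast_ne_zero (by simp [h])⟩

theorem natCast_functionField_ne_zero : (n : F) ≠ 0 := by
  simpa using (algebraMap k F).injective.ne H.natCast_ne_zero

theorem aeval_ne_zero {p : k[X]} (hp : p ≠ 0) : aeval x p ≠ 0 :=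
  fun h => hp (transcendental_iff.1 H.transcendental p h)

theorem x_ne_zero : x ≠ 0 := by
  simpa using H.aeval_ne_zero X_ne_zero

theorem aeval_prodPow_ne_zero (a : Fin r → ℕ) : aeval x (prodPow P a) ≠ 0 :=
  H.aeval_ne_zero (prodPow_ne_zero (fun i => (H.separable i).ne_zero) a)

theorem y_ne_zero : y ≠ 0 := by
  have := H.neZero
  rintro rfl
  exact H.aeval_prodPow_ne_zero l (by rw [← H.pow_eq, zero_pow (NeZero.ne n)])

theorem kummerFun_ne_zero (μ : ℕ) : kummerFun n P l x y μ ≠ 0 :=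
  div_ne_zero (pow_ne_zero _ H.y_ne_zero) (H.aeval_prodPow_ne_zero _)

theorem kummerFun_mul_kummerFun (μ ν : ℕ) :
    kummerFun n P l x y μ * kummerFun n P l x y ν =
      aeval x (prodPow P (carry n l μ ν)) * kummerFun n P l x y (μ + ν) := by
  have hμ := H.aeval_prodPow_ne_zero (quo n l μ)
  have hν := H.aeval_prodPow_ne_zero (quo n l ν)
  have hcarry := H.aeval_prodPow_ne_zero (carry n l μ ν)
  simp only [kummerFun, quo_add, prodPow_add, map_mul]
  field_simp
  ring

theorem kummerFun_add_mul (μ c : ℕ) :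
    kummerFun n P l x y (μ + n * c) = kummerFun n P l x y μ := by
  have := H.neZero
  have hl := H.aeval_prodPow_ne_zero l
  simp only [kummerFun, quo_add_mul, prodPow_add, prodPow_nsmul, map_mul, map_pow, pow_add, pow_mul,
    H.pow_eq]
  field_simp

theorem kummerFun_eq_of_modEq {μ ν : ℕ} (h : μ ≡ ν [MOD n]) :
    kummerFun n P l x y μ = kummerFun n P l x y ν := by
  rw [← Nat.mod_add_div μ n, ← Nat.mod_add_div ν n, H.kummerFun_add_mul, H.kummerFun_add_mul, h]

theorem kummerDiff_eq_of_modEq {μ ν : ℕ} (h : μ ≡ ν [MOD n]) :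
    kummerDiff n P l x y μ = kummerDiff n P l x y ν := by
  rw [kummerDiff, H.kummerFun_eq_of_modEq h, kummerDiff]

theorem kummerFun_mul_kummerFun_of_dvd {μ ν : ℕ} (h : n ∣ μ + ν) :
    kummerFun n P l x y μ * kummerFun n P l x y ν = aeval x (ramPoly n P l μ) := by
  have := H.neZero
  rw [H.kummerFun_mul_kummerFun, prodPow_carry_of_dvd P l h,
    H.kummerFun_eq_of_modEq (Nat.modEq_zero_iff_dvd.2 h), kummerFun_zero, mul_one]

theorem kummerFun_pow (μ : ℕ) :
    kummerFun n P l x y μ ^ n = aeval x (prodPow P fun i => numPts n l i * rem n l μ i) := by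
  have hexp : (fun i => numPts n l i * rem n l μ i) + n • quo n l μ = μ • l :=
    funext (numPts_mul_rem_add_mul_quo l μ)
  rw [kummerFun, div_pow, div_eq_iff (pow_ne_zero _ (H.aeval_prodPow_ne_zero _)), pow_right_comm,
    H.pow_eq]
  simp only [← map_pow, ← map_mul, ← prodPow_nsmul, ← prodPow_add, hexp]

theorem kummerFun_smul_kummerDiff (μ ν : ℕ) :
    kummerFun n P l x y μ • kummerDiff n P l x y (μ + ν) =
      aeval x (prodPow P (carry n l μ ν)) • kummerDiff n P l x y ν := by
  have hν := H.kummerFun_ne_zero ν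
  have hadd := H.kummerFun_ne_zero (μ + ν)
  have hmul := H.kummerFun_mul_kummerFun μ ν
  rw [kummerDiff, kummerDiff, smul_smul, smul_smul]
  congr 1
  field_simp
  rw [hmul, mul_comm]

theorem D_kummerFun {μ ν : ℕ} (h : n ∣ μ + ν) :
    D k F (kummerFun n P l x y μ) =
      ((n : F)⁻¹ * aeval x (dlogPoly n P l μ)) • kummerDiff n P l x y ν := by
  have := H.neZero
  set w := kummerFun n P l x y μ with hw
  have hw0 : w ≠ 0 := H.kummerFun_ne_zero μ
  have hν0 := H.kummerFun_ne_zero ν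
  have hn := H.natCast_functionField_ne_zero
  have hpow : w ^ n = w ^ (n - 1) * w := by rw [← pow_succ, Nat.sub_add_cancel (NeZero.pos n)]
  have hD := congrArg (D k F) (H.kummerFun_pow μ)
  rw [← hw, Derivation.leibniz_pow, Derivation.map_aeval, ← Nat.cast_smul_eq_nsmul F,
    smul_smul] at hD
  have hder := congrArg (aeval x) (derivative_prodPow_mul_ramPoly P l (n := n) (μ := μ))
  rw [map_mul, map_mul, ← H.kummerFun_pow, ← H.kummerFun_mul_kummerFun_of_dvd h, ← hw, hpow] at hder
  have hcancel : (n : F)⁻¹ * aeval x (dlogPoly n P l μ) * (kummerFun n P l x y ν)⁻¹ =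
      ((n : F) * w ^ (n - 1))⁻¹ *
        aeval x (derivative (prodPow P fun i => numPts n l i * rem n l μ i)) := by
    field_simp
    exact mul_right_cancel₀ hw0 (by linear_combination -hder)
  rw [kummerDiff, smul_smul, hcancel, mul_smul, ← hD,
    inv_smul_smul₀ (mul_ne_zero hn (pow_ne_zero _ hw0))]

theorem D_zpow_mul_kummerFun {μ ν : ℕ} (h : n ∣ μ + ν) (m : ℤ) :
    D k F (x ^ m * kummerFun n P l x y μ) =
      (m * x ^ (m - 1) * aeval x (ramPoly n P l μ) +
        (n : F)⁻¹ * x ^ m * aeval x (dlogPoly n P l μ)) • kummerDiff n P l x y ν := by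
  have hν := H.kummerFun_ne_zero ν
  have hDx : D k F x = kummerFun n P l x y ν • kummerDiff n P l x y ν := by
    rw [kummerDiff, smul_inv_smul₀ hν]
  rw [Derivation.leibniz, H.D_kummerFun h, Derivation.leibniz_zpow, hDx,
    ← H.kummerFun_mul_kummerFun_of_dvd h]
  simp only [smul_smul, ← Int.cast_smul_eq_zsmul F, ← add_smul]
  congr 1
  ring

end IsKummerCover

end KummerCover

section LaurentFamily

variable {k F M ι : Type*} [Field k] [Field F] [Algebra k F] [AddCommGroup M] [Module k M]
  [Module F M] {x : F} {v : ι → M}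

/-- The family of the elements `x ^ m v_j`, which spans the Laurent polynomials in `x` with
coefficients `v_j`. -/
def laurentFamily (x : F) (v : ι → M) (q : ℤ × ι) : M := x ^ q.1 • v q.2

theorem linearIndependent_zpow (hx : Transcendental k x) :
    LinearIndependent k fun m : ℤ => x ^ m := by
  have hx0 : x ≠ 0 := fun h => hx (h ▸ isAlgebraic_zero)
  have hpow : LinearIndependent k fun m : ℕ => x ^ m := by
    simpa [Function.comp_def] using (basisMonomials k).linearIndependent.map'
      (aeval x).toLinearMap (LinearMap.ker_eq_bot.2 (transcendental_iff_injective.1 hx))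
  refine linearIndependent_iff_finset_linearIndependent.2 fun s => ?_
  obtain ⟨N, hN⟩ := s.bddBelow
  have hinj : Function.Injective fun m : s => (m - N : ℤ).toNat := fun a b hab => by
    have := hN a.2
    have := hN b.2
    refine Subtype.ext ?_
    simp only at hab
    omega
  have hshift : (fun m : ℤ => x ^ m) ∘ Subtype.val =
      LinearMap.mulLeft k (x ^ N) ∘ fun m : s => x ^ (m - N : ℤ).toNat := by
    funext m
    have := hN m.2
    rw [Function.comp_apply, Function.comp_apply, LinearMap.mulLeft_apply, ← zpow_natCast,
      Int.toNat_of_nonneg (by omega), ← zpow_add₀ hx0, add_sub_cancel]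
  rw [hshift]
  exact (hpow.comp _ hinj).map' _
    (LinearMap.ker_eq_bot.2 (mul_right_injective₀ (zpow_ne_zero N hx0)))

variable [IsScalarTower k F M]

theorem linearIndependent_laurentFamily (hx : Transcendental k x)
    (hv : LinearIndependent k⟮x⟯ v) : LinearIndependent k (laurentFamily x v) := by
  have hgen : Transcendental k (IntermediateField.AdjoinSimple.gen k x) :=
    (transcendental_algebraMap_iff (algebraMap k⟮x⟯ F).injective).1 hx
  have : IsScalarTower k k⟮x⟯ M := ⟨fun a b m => smul_assoc a (b : F) m⟩
  have hmul := linearIndependent_smul (linearIndependent_zpow hgen) hv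
  exact hmul

theorem zpow_mul_aeval_smul_mem_span (hx : x ≠ 0) {m : ℤ} {p : k[X]} {j : ι} {S : Set (ℤ × ι)}
    (hS : ∀ i ∈ p.support, (m + i, j) ∈ S) :
    (x ^ m * aeval x p) • v j ∈ Submodule.span k (laurentFamily x v '' S) := by
  rw [aeval_eq_sum_range, ← Finset.sum_subset (supp_subset_range_natDegree_succ (p := p))
    fun i _ hi => by rw [notMem_support_iff.1 hi, zero_smul], Finset.mul_sum, Finset.sum_smul]
  refine Submodule.sum_mem _ fun i hi => ?_
  rw [mul_smul_comm, smul_assoc, ← zpow_natCast, ← zpow_add₀ hx]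
  exact Submodule.smul_mem _ _ (Submodule.subset_span ⟨_, hS i hi, rfl⟩)

theorem aeval_smul_mem_span (hx : x ≠ 0) (p : k[X]) (j : ι) :
    aeval x p • v j ∈ Submodule.span k (laurentFamily x v '' {q | 0 ≤ q.1}) := by
  simpa using zpow_mul_aeval_smul_mem_span (v := v) hx (m := 0) (p := p) (j := j)
    (S := {q | 0 ≤ q.1}) (by simp)

theorem span_laurentFamily_inv {v' : ι → M} {e : ι → ℤ} {c : k} (hc : c ≠ 0) (hx : x ≠ 0)
    (hv : ∀ j, v' j = c • x ^ e j • v j) :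
    Submodule.span k (laurentFamily x⁻¹ v' '' {q | 0 ≤ q.1}) =
      Submodule.span k (laurentFamily x v '' {q | q.1 ≤ e q.2}) := by
  have hterm (m : ℤ) (j : ι) :
      laurentFamily x⁻¹ v' (m, j) = c • laurentFamily x v (e j - m, j) := by
    rw [laurentFamily, laurentFamily, hv, smul_algebra_smul_comm, smul_smul, inv_zpow',
      ← zpow_add₀ hx, neg_add_eq_sub]
  apply le_antisymm <;> rw [Submodule.span_le]
  · rintro _ ⟨⟨m, j⟩, hm, rfl⟩
    rw [hterm]
    exact Submodule.smul_mem _ _ (Submodule.subset_span ⟨_, by simpa using hm, rfl⟩)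
  · rintro _ ⟨⟨m, j⟩, hm, rfl⟩
    rw [← inv_smul_smul₀ hc (laurentFamily x v (m, j)), ← sub_sub_cancel (e j) m, ← hterm]
    exact Submodule.smul_mem _ _ (Submodule.subset_span ⟨_, by simpa using hm, rfl⟩)

end LaurentFamily

/-! ### Regular functions -/

section RegularFunctions

variable {k F : Type*} [Field k] [Field F] [Algebra k F] {n r : ℕ} {P : Fin r → k[X]}
  {l : Fin r → ℕ} {x y : F}

theorem mem_regFun_of_mem {S : Set F} {a : F} (ha : a ∈ S) : a ∈ regFun k S :=
  isIntegral_algebraMap (x := (⟨a, Algebra.subset_adjoin ha⟩ : Algebra.adjoin k S))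

theorem aeval_mem_regFun (p : k[X]) : aeval x p ∈ regFun k {x} := by
  have hx : x ∈ regFun k {x} := mem_regFun_of_mem rfl
  exact (Algebra.adjoin_singleton_le hx) (aeval_mem_adjoin_singleton k x)

theorem coe_aeval_gen (p : k[X]) :
    ((aeval (IntermediateField.AdjoinSimple.gen k x) p : k⟮x⟯) : F) = aeval x p :=
  coe_aeval_mk_apply _ _

theorem linearIndependent_of_eq_smul {K M ι : Type*} [Field K] [AddCommGroup M] [Module K M]
    {v v' : ι → M} (hv : LinearIndependent K v) {a : ι → K} (ha : ∀ j, a j ≠ 0)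
    (h : ∀ j, v' j = a j • v j) : LinearIndependent K v' := by
  rw [funext h]
  exact hv.units_smul fun j => Units.mk0 (a j) (ha j)

theorem kummerFun_eq_smul (μ : ℕ) : kummerFun n P l x y μ =
    (aeval (IntermediateField.AdjoinSimple.gen k x) (prodPow P (quo n l μ)))⁻¹ • y ^ μ := by
  rw [kummerFun, Algebra.smul_def, map_inv₀, IntermediateField.algebraMap_apply, coe_aeval_gen,
    div_eq_inv_mul]

namespace IsKummerCover

variable (H : IsKummerCover n P l x y)
include H

theorem adjoin_simple_eq_top : k⟮x⟯⟮y⟯ = ⊤ := by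
  rw [← IntermediateField.restrictScalars_eq_top_iff (K := k),
    IntermediateField.adjoin_simple_adjoin_simple, H.adjoin_eq_top]

theorem linearIndependent_y_pow : LinearIndependent k⟮x⟯ fun j : Fin n => y ^ (j : ℕ) :=
  have := H.neZero
  linearIndependent_pow_of_adjoin_eq_top H.adjoin_simple_eq_top H.finrank_eq

theorem linearIndependent_y_inv_pow : LinearIndependent k⟮x⟯ fun j : Fin n => y⁻¹ ^ (j : ℕ) := by
  have := H.neZero
  refine linearIndependent_pow_of_adjoin_eq_top ?_ H.finrank_eq
  rw [eq_top_iff, ← H.adjoin_simple_eq_top, IntermediateField.adjoin_simple_le_iff, ← inv_mem_iff]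
  exact IntermediateField.mem_adjoin_simple_self _ _

theorem aeval_gen_prodPow_ne_zero (a : Fin r → ℕ) :
    aeval (IntermediateField.AdjoinSimple.gen k x) (prodPow P a) ≠ 0 := fun h =>
  H.aeval_prodPow_ne_zero a (by rw [← coe_aeval_gen, h, ZeroMemClass.coe_zero])

theorem linearIndependent_kummerFun :
    LinearIndependent k⟮x⟯ fun j : Fin n => kummerFun n P l x y j :=
  linearIndependent_of_eq_smul H.linearIndependent_y_pow
    (fun j => inv_ne_zero (H.aeval_gen_prodPow_ne_zero (quo n l j)))
    fun _ => kummerFun_eq_smul _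

theorem linearIndependent_inv_kummerFun :
    LinearIndependent k⟮x⟯ fun j : Fin n => (kummerFun n P l x y j)⁻¹ :=
  linearIndependent_of_eq_smul H.linearIndependent_y_inv_pow
    (fun j => H.aeval_gen_prodPow_ne_zero (quo n l j)) fun j => by
      rw [kummerFun, Algebra.smul_def, IntermediateField.algebraMap_apply, coe_aeval_gen, inv_div,
        inv_pow, div_eq_mul_inv]

theorem exists_eq_sum_smul_kummerFun (b : F) :
    ∃ c : Fin n → k⟮x⟯, b = ∑ j, c j • kummerFun n P l x y j := by
  have := H.neZero
  have : FiniteDimensional k⟮x⟯ F := .of_finrank_pos (H.finrank_eq ▸ NeZero.pos n)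
  have hspan := H.linearIndependent_kummerFun.span_eq_top_of_card_eq_finrank'
    (by rw [Fintype.card_fin, H.finrank_eq])
  obtain ⟨c, hc⟩ := (Submodule.mem_span_range_iff_exists_fun _).1
    (hspan ▸ Submodule.mem_top (x := b))
  exact ⟨c, hc.symm⟩

theorem kummerFun_mem_regFun (μ : ℕ) : kummerFun n P l x y μ ∈ regFun k {x} := by
  have := H.neZero
  refine IsIntegral.of_pow (NeZero.pos n) ?_
  rw [H.kummerFun_pow]
  exact aeval_mem_regFun _

open scoped IntermediateField.algebraAdjoinAdjoin in
theorem smul_kummerFun_mem_regFun {c : Fin n → k⟮x⟯}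
    (hc : ∑ j, c j • kummerFun n P l x y j ∈ regFun k {x}) (j : Fin n) :
    c j • kummerFun n P l x y j ∈ regFun k {x} := by
  have := H.neZero
  have hn : IsUnit ((n : ℕ) : Algebra.adjoin k {x}) := by
    simpa using (Ne.isUnit H.natCast_ne_zero).map (algebraMap k (Algebra.adjoin k {x}))
  have hpow : y ^ n = algebraMap k⟮x⟯ F
      (aeval (IntermediateField.AdjoinSimple.gen k x) (prodPow P l)) := by
    rw [H.pow_eq, IntermediateField.algebraMap_apply, coe_aeval_gen]
  simp only [kummerFun_eq_smul, smul_smul] at hc ⊢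
  exact isIntegral_component hn H.adjoin_simple_eq_top H.finrank_eq hpow hc j

theorem isUnit_of_pow_dvd_prodPow {μ : ℕ} {q : k[X]}
    (hq : q ^ n ∣ prodPow P fun i => numPts n l i * rem n l μ i) : IsUnit q := by
  have := H.neZero
  have hsquarefree : Squarefree (∏ i, P i) := by
    refine Finset.squarefree_prod_of_pairwise_isCoprime (fun i _ j _ hij => ?_)
      fun i _ => (H.separable i).squarefree
    exact (H.pairwise_isCoprime hij).isRelPrime
  have hle : (fun i => numPts n l i * rem n l μ i) ≤ (n - 1) • (1 : Fin r → ℕ) := fun i => by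
    simpa using Nat.le_sub_one_of_lt (numPts_mul_rem_lt l μ i)
  refine isUnit_of_pow_succ_dvd_pow_of_squarefree hsquarefree (m := n - 1) ?_
  rw [Nat.sub_add_cancel (NeZero.pos n)]
  have hdvd := hq.trans (prodPow_dvd_prodPow P hle)
  rw [prodPow_nsmul] at hdvd
  simpa only [prodPow, Pi.one_apply, pow_one] using hdvd

open scoped IntermediateField.algebraAdjoinAdjoin in
theorem exists_aeval_eq_of_smul_mem_regFun {μ : ℕ} {c : k⟮x⟯}
    (hc : c • kummerFun n P l x y μ ∈ regFun k {x}) : ∃ p : k[X], aeval x p = c := by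
  set e := algEquivOfTranscendental k x H.transcendental
  set d := prodPow P fun i => numPts n l i * rem n l μ i
  have he (p : k[X]) : (e p : F) = aeval x p := coe_aeval_mk_apply _ _
  have : UniqueFactorizationMonoid (Algebra.adjoin k {x}) :=
    e.toMulEquiv.uniqueFactorizationMonoid inferInstance
  have hd (q : Algebra.adjoin k {x}) (hq : q ^ n ∣ e d) : IsUnit q := by
    obtain ⟨q, rfl⟩ := e.surjective q
    rw [← map_pow, map_dvd_iff] at hq
    exact (H.isUnit_of_pow_dvd_prodPow hq).map e
  have hint : IsIntegral (Algebra.adjoin k {x}) (c ^ n * algebraMap _ k⟮x⟯ (e d)) := by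
    rw [← isIntegral_algebraMap_iff (algebraMap k⟮x⟯ F).injective]
    have hpow : IsIntegral (Algebra.adjoin k {x}) ((c • kummerFun n P l x y μ) ^ n) := hc.pow n
    rw [Algebra.smul_def, mul_pow, H.kummerFun_pow, ← he] at hpow
    simpa using hpow
  obtain ⟨a, ha⟩ := isInteger_of_isIntegral_pow_mul hd hint
  obtain ⟨p, rfl⟩ := e.surjective a
  exact ⟨p, by rw [← ha, ← he]; rfl⟩

theorem regFun_eq_span : Subalgebra.toSubmodule (regFun k {x}) =
    Submodule.span k (laurentFamily x (fun j : Fin n => kummerFun n P l x y j) ''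
      {q | 0 ≤ q.1}) := by
  apply le_antisymm
  · intro b hb
    obtain ⟨c, rfl⟩ := H.exists_eq_sum_smul_kummerFun b
    refine Submodule.sum_mem _ fun j _ => ?_
    have hj : c j • kummerFun n P l x y j ∈ regFun k {x} := H.smul_kummerFun_mem_regFun hb j
    obtain ⟨p, hp⟩ := H.exists_aeval_eq_of_smul_mem_regFun hj
    rw [Algebra.smul_def, IntermediateField.algebraMap_apply, ← hp]
    exact aeval_smul_mem_span (v := fun j : Fin n => kummerFun n P l x y j) H.x_ne_zero p j
  · rw [Submodule.span_le]
    rintro _ ⟨⟨m, j⟩, hm, rfl⟩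
    obtain ⟨m, rfl⟩ := Int.eq_ofNat_of_zero_le hm
    have hmul : x ^ m * kummerFun n P l x y j ∈ regFun k {x} :=
      mul_mem (pow_mem (mem_regFun_of_mem (Set.mem_singleton x)) m) (H.kummerFun_mem_regFun _)
    simpa only [laurentFamily, zpow_natCast, smul_eq_mul, SetLike.mem_coe,
      Subalgebra.mem_toSubmodule] using hmul

end IsKummerCover

end RegularFunctions

/-! ### Regular differentials -/

section RegularDifferentials

theorem smul_mem_of_mem_span {R A M : Type*} [CommSemiring R] [Semiring A] [Algebra R A]
    [AddCommMonoid M] [Module R M] [Module A M] [IsScalarTower R A M] {s : Set A} {t : Set M}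
    {N : Submodule R M} (h : ∀ a ∈ s, ∀ m ∈ t, a • m ∈ N) {a : A} {m : M}
    (ha : a ∈ Submodule.span R s) (hm : m ∈ Submodule.span R t) : a • m ∈ N := by
  have hmem := Submodule.apply_mem_map₂ (Algebra.lsmul R R M).toLinearMap ha hm
  rw [Submodule.map₂_span_span] at hmem
  refine Submodule.span_le.2 ?_ hmem
  rintro _ ⟨a, ha, m, hm, rfl⟩
  exact h a ha m hm

variable {k F : Type*} [Field k] [Field F] [Algebra k F]

theorem smul_mem_regDiff {S : Set F} {a : F} (ha : a ∈ regFun k S) {ω : Ω[F⁄k]}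
    (hω : ω ∈ regDiff k S) : a • ω ∈ regDiff k S := by
  obtain ⟨τ, rfl⟩ := hω
  exact ⟨(⟨a, ha⟩ : regFun k S) • τ, map_smul (KaehlerDifferential.map k k (regFun k S) F) _ τ⟩

theorem regDiff_le {S : Set F} {M : Submodule k Ω[F⁄k]} (hD : ∀ a ∈ regFun k S, D k F a ∈ M)
    (hM : ∀ a ∈ regFun k S, ∀ ω ∈ M, a • ω ∈ M) : regDiff k S ≤ M := by
  rintro _ ⟨τ, rfl⟩
  have hτ : τ ∈ Submodule.span (regFun k S) (Set.range (D k (regFun k S))) := by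
    rw [KaehlerDifferential.span_range_derivation]
    exact Submodule.mem_top
  induction hτ using Submodule.span_induction with
  | mem τ h =>
    obtain ⟨a, rfl⟩ := h
    simpa [KaehlerDifferential.map_D] using hD a a.2
  | zero => simp
  | add τ τ' _ _ h h' => rw [map_add]; exact M.add_mem h h'
  | smul a τ _ h =>
    have hsmul := map_smul (KaehlerDifferential.map k k (regFun k S) F) a τ
    exact hsmul ▸ hM a a.2 _ h

variable {n r : ℕ} {P : Fin r → k[X]} {l : Fin r → ℕ} {x y : F}

namespace IsKummerCover

variable (H : IsKummerCover n P l x y)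
include H

theorem aeval_smul_kummerDiff_mem_span (p : k[X]) (μ : ℕ) :
    aeval x p • kummerDiff n P l x y μ ∈
      Submodule.span k (laurentFamily x (fun j : Fin n => kummerDiff n P l x y j) ''
        {q | 0 ≤ q.1}) := by
  have := H.neZero
  rw [← H.kummerDiff_eq_of_modEq (Nat.mod_modEq μ n)]
  exact aeval_smul_mem_span (v := fun j : Fin n => kummerDiff n P l x y j) H.x_ne_zero p
    ⟨μ % n, Nat.mod_lt _ (NeZero.pos n)⟩

theorem exists_kummerFun_smul_kummerDiff_eq (μ κ : ℕ) : ∃ (p : k[X]) (ν : ℕ),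
    kummerFun n P l x y μ • kummerDiff n P l x y κ = aeval x p • kummerDiff n P l x y ν := by
  have := H.neZero
  obtain ⟨m, hm⟩ := exists_dvd_add (n := n) μ
  have hκ : κ ≡ μ + (m + κ) [MOD n] := by
    simpa [add_assoc] using ((Nat.modEq_zero_iff_dvd.2 hm).add_right κ).symm
  exact ⟨_, m + κ, by rw [H.kummerDiff_eq_of_modEq hκ, H.kummerFun_smul_kummerDiff]⟩

theorem smul_mem_span_kummerDiff {a : F} (ha : a ∈ regFun k {x}) {ω : Ω[F⁄k]}
    (hω : ω ∈ Submodule.span k (laurentFamily x (fun j : Fin n => kummerDiff n P l x y j) ''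
      {q | 0 ≤ q.1})) :
    a • ω ∈ Submodule.span k (laurentFamily x (fun j : Fin n => kummerDiff n P l x y j) ''
      {q | 0 ≤ q.1}) := by
  rw [← Subalgebra.mem_toSubmodule, H.regFun_eq_span] at ha
  refine smul_mem_of_mem_span ?_ ha hω
  rintro _ ⟨⟨a, i⟩, ha, rfl⟩ _ ⟨⟨b, j⟩, hb, rfl⟩
  obtain ⟨a, rfl⟩ := Int.eq_ofNat_of_zero_le ha
  obtain ⟨b, rfl⟩ := Int.eq_ofNat_of_zero_le hb
  obtain ⟨p, κ, hp⟩ := H.exists_kummerFun_smul_kummerDiff_eq i j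
  have hmul : (x ^ a * kummerFun n P l x y i) • x ^ b • kummerDiff n P l x y j =
      aeval x (X ^ (a + b) * p) • kummerDiff n P l x y κ := by
    rw [map_mul, mul_smul _ (aeval x p), ← hp, smul_smul, smul_smul, map_pow, aeval_X]
    ring_nf
  simp only [laurentFamily, zpow_natCast, smul_eq_mul, hmul]
  exact H.aeval_smul_kummerDiff_mem_span _ _

theorem D_mem_span_kummerDiff {a : F} (ha : a ∈ regFun k {x}) :
    D k F a ∈ Submodule.span k (laurentFamily x (fun j : Fin n => kummerDiff n P l x y j) ''
      {q | 0 ≤ q.1}) := by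
  have := H.neZero
  set M := Submodule.span k (laurentFamily x (fun j : Fin n => kummerDiff n P l x y j) ''
    {q | 0 ≤ q.1})
  have hx : D k F x ∈ M := by
    have hzero : D k F x = aeval x (1 : k[X]) • kummerDiff n P l x y 0 := by
      rw [kummerDiff, kummerFun_zero, inv_one, one_smul, map_one, one_smul]
    exact hzero ▸ H.aeval_smul_kummerDiff_mem_span 1 0
  have hw (μ : ℕ) : D k F (kummerFun n P l x y μ) ∈ M := by
    obtain ⟨ν, hν⟩ := exists_dvd_add (n := n) μ
    rw [H.D_kummerFun hν]
    have hmap : (n : F)⁻¹ * aeval x (dlogPoly n P l μ) =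
        aeval x (C (n : k)⁻¹ * dlogPoly n P l μ) := by simp
    exact hmap ▸ H.aeval_smul_kummerDiff_mem_span _ ν
  rw [← Subalgebra.mem_toSubmodule, H.regFun_eq_span] at ha
  refine (Submodule.span_le (p := M.comap (D k F).toLinearMap)).2 ?_ ha
  rintro _ ⟨⟨m, j⟩, hm, rfl⟩
  obtain ⟨m, rfl⟩ := Int.eq_ofNat_of_zero_le hm
  have hpow (a : ℕ) : x ^ a ∈ regFun k {x} :=
    pow_mem (mem_regFun_of_mem (Set.mem_singleton x)) a
  have hDpow : D k F (x ^ m) ∈ M := by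
    rw [Derivation.leibniz_pow]
    exact M.nsmul_mem (H.smul_mem_span_kummerDiff (hpow _) hx) m
  simp only [laurentFamily, zpow_natCast, smul_eq_mul, SetLike.mem_coe, Submodule.mem_comap,
    Derivation.coeFn_coe, Derivation.leibniz]
  exact M.add_mem (H.smul_mem_span_kummerDiff (hpow m) (hw j))
    (H.smul_mem_span_kummerDiff (H.kummerFun_mem_regFun j) hDpow)

theorem aeval_dlogPoly_mul_prodPow_smul_mem_regDiff {μ ν κ : ℕ} (h : n ∣ μ + (ν + κ)) :
    aeval x (dlogPoly n P l μ * prodPow P (carry n l ν κ)) • kummerDiff n P l x y κ ∈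
      regDiff k {x} := by
  have hn := H.natCast_functionField_ne_zero
  have hD : n • kummerFun n P l x y ν • D k F (kummerFun n P l x y μ) ∈ regDiff k {x} :=
    (regDiff k {x}).nsmul_mem
      (smul_mem_regDiff (H.kummerFun_mem_regFun ν) (D_mem_regDiff k (H.kummerFun_mem_regFun μ))) n
  rwa [H.D_kummerFun h, smul_comm (kummerFun n P l x y ν), H.kummerFun_smul_kummerDiff,
    ← Nat.cast_smul_eq_nsmul F, mul_smul, smul_inv_smul₀ hn, smul_smul, ← map_mul] at hD

theorem aeval_ramPoly_smul_mem_regDiff (κ : ℕ) :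
    aeval x (ramPoly n P l κ) • kummerDiff n P l x y κ ∈ regDiff k {x} := by
  have := H.neZero
  obtain ⟨μ, hμ⟩ := exists_dvd_add (n := n) κ
  rw [kummerDiff, smul_smul, ← H.kummerFun_mul_kummerFun_of_dvd hμ,
    mul_right_comm, mul_inv_cancel₀ (H.kummerFun_ne_zero κ), one_mul]
  exact smul_mem_regDiff (H.kummerFun_mem_regFun μ)
    (D_mem_regDiff k (mem_regFun_of_mem (Set.mem_singleton x)))

theorem kummerDiff_mem_regDiff (κ : ℕ) : kummerDiff n P l x y κ ∈ regDiff k {x} := by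
  have := H.neZero
  let N : Ideal k[X] :=
    { carrier := {p | aeval x p • kummerDiff n P l x y κ ∈ regDiff k {x}}
      zero_mem' := by simp
      add_mem' hp hq := by simpa [add_smul] using (regDiff k {x}).add_mem hp hq
      smul_mem' p q hq := by
        simpa [mul_smul] using smul_mem_regDiff (aeval_mem_regFun p) hq }
  have hN : N = ⊤ := by
    refine eq_top_of_prod_mem_of_exists_isCoprime (H.aeval_ramPoly_smul_mem_regDiff κ)
      fun i hi => ?_
    have hκ : rem n l κ i ≠ 0 := by simpa [ramSet] using hi
    have hlt := rem_lt (n := n) l κ i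
    obtain ⟨μ, hμ⟩ := exists_rem_eq_one l (i := i) (n := n) (by lia)
    obtain ⟨ν, hν⟩ := exists_dvd_add (n := n) (μ + κ)
    replace hν : n ∣ μ + (ν + κ) := by rwa [add_comm ν, ← add_assoc]
    exact ⟨_, H.aeval_dlogPoly_mul_prodPow_smul_mem_regDiff hν,
      (isCoprime_dlogPoly l (H.separable i) H.pairwise_isCoprime H.natCast_ne_zero hμ).mul_left
        (isCoprime_prodPow H.pairwise_isCoprime (carry_eq_zero_of_rem_eq_one l hν hμ))⟩
  have hone : (1 : k[X]) ∈ N := hN ▸ Submodule.mem_top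
  simpa [N] using hone

theorem regDiff_eq_span : regDiff k {x} =
    Submodule.span k (laurentFamily x (fun j : Fin n => kummerDiff n P l x y j) ''
      {q | 0 ≤ q.1}) := by
  apply le_antisymm
  · exact regDiff_le (fun a ha => H.D_mem_span_kummerDiff ha) fun a ha ω hω =>
      H.smul_mem_span_kummerDiff ha hω
  · rw [Submodule.span_le]
    rintro _ ⟨⟨m, j⟩, hm, rfl⟩
    obtain ⟨m, rfl⟩ := Int.eq_ofNat_of_zero_le hm
    have hsmul : x ^ m • kummerDiff n P l x y j ∈ regDiff k {x} :=
      smul_mem_regDiff (pow_mem (mem_regFun_of_mem (Set.mem_singleton x)) m)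
        (H.kummerDiff_mem_regDiff j)
    simpa only [laurentFamily, zpow_natCast, SetLike.mem_coe] using hsmul

end IsKummerCover

end RegularDifferentials

section Nonvanishing

variable {k F : Type*} [Field k] [Field F] [Algebra k F]

theorem derivation_eq_zero_of_adjoin_eq_top {M : Type*} [AddCommGroup M] [Module k M] [Module F M]
    {s : Set F} (hs : IntermediateField.adjoin k s = ⊤)
    {d : Derivation k F M} (hd : ∀ a ∈ s, d a = 0) : d = 0 := by
  ext a
  have ha : a ∈ IntermediateField.adjoin k s := hs ▸ IntermediateField.mem_top
  rw [Derivation.zero_apply]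
  induction ha using IntermediateField.adjoin_induction with
  | mem a ha => exact hd a ha
  | algebraMap c => exact d.map_algebraMap c
  | add a b _ _ ha hb => rw [map_add, ha, hb, add_zero]
  | inv a _ ha => rw [d.leibniz_inv, ha, smul_zero]
  | mul a b _ _ ha hb => rw [d.leibniz, ha, hb, smul_zero, smul_zero, add_zero]

theorem isAlgebraic_of_D_eq_zero {s : Set F} (hfin : s.Finite)
    (hs : IntermediateField.adjoin k s = ⊤) (hD : ∀ a ∈ s, D k F a = 0) :
    Algebra.IsAlgebraic k F := by
  have hzero : D k F = 0 := derivation_eq_zero_of_adjoin_eq_top hs hD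
  have hunr : Algebra.FormallyUnramified k F := by
    refine ⟨subsingleton_of_forall_eq 0 fun ω => ?_⟩
    have hspan := KaehlerDifferential.span_range_derivation k F
    simpa [hzero] using hspan.ge (Submodule.mem_top (x := ω))
  have hess : Algebra.EssFiniteType k F :=
    IntermediateField.fg_top_iff.1 (IntermediateField.fg_def.2 ⟨s, hfin, hs⟩)
  have := Algebra.FormallyUnramified.finite_of_free k F
  exact Algebra.IsAlgebraic.of_finite k F

variable {n r : ℕ} {P : Fin r → k[X]} {l : Fin r → ℕ} {x y : F}

namespace IsKummerCover

variable (H : IsKummerCover n P l x y)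
include H

theorem D_x_ne_zero : D k F x ≠ 0 := by
  intro hx
  have := H.neZero
  have hn := H.natCast_functionField_ne_zero
  have hy : D k F y = 0 := by
    have hpow := congrArg (D k F) H.pow_eq
    rw [Derivation.leibniz_pow, Derivation.map_aeval, hx, smul_zero, ← Nat.cast_smul_eq_nsmul F,
      smul_smul] at hpow
    exact (smul_eq_zero.1 hpow).resolve_left (mul_ne_zero hn (pow_ne_zero _ H.y_ne_zero))
  have halg := isAlgebraic_of_D_eq_zero (Set.toFinite {x, y}) H.adjoin_eq_top (by simp [hx, hy])
  exact H.transcendental (halg.isAlgebraic x)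

theorem linearIndependent_kummerDiff :
    LinearIndependent k⟮x⟯ fun j : Fin n => kummerDiff n P l x y j :=
  H.linearIndependent_inv_kummerFun.map_injOn
    ((LinearMap.toSpanSingleton F Ω[F⁄k] (D k F x)).restrictScalars k⟮x⟯)
    (smul_left_injective F H.D_x_ne_zero).injOn

end IsKummerCover

end Nonvanishing

/-! ### The coordinate `1/x` -/

section Inversion

variable {k F : Type*} [Field k] [Field F] [Algebra k F] {n r : ℕ} {ρ : Fin r → k}
  {l : Fin r → ℕ} {x y : F}

theorem aeval_inv_prodPow (hx : x ≠ 0) (ρ : Fin r → k) (a : Fin r → ℕ) :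
    aeval x⁻¹ (prodPow (fun i => 1 - C (ρ i) * X) a) =
      aeval x (prodPow (fun i => X - C (ρ i)) a) / x ^ ∑ i, a i := by
  simp only [prodPow, map_prod, map_pow, map_sub, map_mul, map_one, aeval_X, aeval_C,
    ← Finset.prod_pow_eq_pow_sum, ← Finset.prod_div_distrib, ← div_pow]
  exact Finset.prod_congr rfl fun i _ => by field_simp

theorem isCoprime_one_sub_C_mul_X {a b : k} (h : a ≠ b) :
    IsCoprime (1 - C a * X) (1 - C b * X : k[X]) := by
  have hinv : C (a - b)⁻¹ * (C a - C b) = (1 : k[X]) := by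
    rw [← C_sub, ← C_mul, inv_mul_cancel₀ (sub_ne_zero.2 h), C_1]
  exact ⟨-(C (a - b)⁻¹ * C b), C (a - b)⁻¹ * C a, by linear_combination hinv⟩

theorem separable_one_sub_C_mul_X (a : k) : (1 - C a * X : k[X]).Separable :=
  ⟨1, -X, by simp⟩

namespace IsKummerCover

variable (H : IsKummerCover n (fun i => X - C (ρ i)) l x y)
include H

theorem inv {L : ℕ} (hL : ∑ i, l i = n * L) :
    IsKummerCover n (fun i => 1 - C (ρ i) * X) l x⁻¹ (y / x ^ L) where
  natCast_ne_zero := H.natCast_ne_zero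
  separable i := separable_one_sub_C_mul_X (ρ i)
  pairwise_isCoprime i j hij := isCoprime_one_sub_C_mul_X fun h =>
    not_isUnit_X_sub_C (ρ j) <| isCoprime_self.1 <| by
      simpa [Function.onFun, h] using H.pairwise_isCoprime hij
  transcendental h := H.transcendental (by simpa using h.inv)
  pow_eq := by
    rw [aeval_inv_prodPow H.x_ne_zero, div_pow, H.pow_eq, ← pow_mul', hL]
  adjoin_eq_top := by
    have hx : x ∈ k⟮x⁻¹, y / x ^ L⟯ := by
      rw [← inv_mem_iff]
      exact IntermediateField.subset_adjoin _ _ (by simp)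
    have hy : y ∈ k⟮x⁻¹, y / x ^ L⟯ := by
      have hdiv : y / x ^ L ∈ k⟮x⁻¹, y / x ^ L⟯ := IntermediateField.subset_adjoin _ _ (by simp)
      simpa [div_mul_cancel₀ y (pow_ne_zero L H.x_ne_zero)] using mul_mem hdiv (pow_mem hx L)
    rw [eq_top_iff, ← H.adjoin_eq_top, IntermediateField.adjoin_le_iff]
    rintro z (rfl | rfl)
    exacts [hx, hy]
  finrank_eq := by
    have hadj : k⟮x⁻¹⟯ = k⟮x⟯ := by
      apply le_antisymm <;> rw [IntermediateField.adjoin_simple_le_iff]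
      · exact inv_mem (IntermediateField.mem_adjoin_simple_self k x)
      · simpa using inv_mem (IntermediateField.mem_adjoin_simple_self k x⁻¹)
    rw [hadj, H.finrank_eq]

theorem kummerFun_inv {L : ℕ} (hL : ∑ i, l i = n * L) (μ : ℕ) :
    kummerFun n (fun i => 1 - C (ρ i) * X) l x⁻¹ (y / x ^ L) μ =
      x ^ (-tt n l μ : ℤ) * kummerFun n (fun i => X - C (ρ i)) l x y μ := by
  have := H.neZero
  have hx := H.x_ne_zero
  have hquo := H.aeval_prodPow_ne_zero (quo n l μ)
  rw [kummerFun, kummerFun, aeval_inv_prodPow hx, tt_eq_mul_sub_sum_quo l hL, neg_sub,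
    zpow_sub₀ hx]
  norm_cast
  rw [mul_comm μ, div_pow, ← pow_mul]
  field_simp

theorem kummerDiff_inv {L : ℕ} (hL : ∑ i, l i = n * L) (μ : ℕ) :
    kummerDiff n (fun i => 1 - C (ρ i) * X) l x⁻¹ (y / x ^ L) μ =
      (-1 : k) • x ^ (tt n l μ - 2 : ℤ) • kummerDiff n (fun i => X - C (ρ i)) l x y μ := by
  have hx := H.x_ne_zero
  rw [kummerDiff, kummerDiff, H.kummerFun_inv hL, Derivation.leibniz_inv, neg_one_smul,
    zpow_sub₀ hx, zpow_neg, zpow_ofNat, neg_smul, smul_neg, smul_smul, smul_smul]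
  congr 2
  field_simp

theorem regFun_inv_eq_span (hl : n ∣ ∑ i, l i) : Subalgebra.toSubmodule (regFun k {x⁻¹}) =
    Submodule.span k (laurentFamily x
      (fun j : Fin n => kummerFun n (fun i => X - C (ρ i)) l x y j) ''
        {q | q.1 ≤ -tt n l q.2}) := by
  obtain ⟨L, hL⟩ := hl
  rw [(H.inv hL).regFun_eq_span]
  refine span_laurentFamily_inv (e := fun j : Fin n => -(tt n l j : ℤ)) (one_ne_zero (α := k))
    H.x_ne_zero fun j => ?_
  rw [H.kummerFun_inv hL, one_smul, smul_eq_mul]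

theorem regDiff_inv_eq_span (hl : n ∣ ∑ i, l i) : regDiff k {x⁻¹} =
    Submodule.span k (laurentFamily x
      (fun j : Fin n => kummerDiff n (fun i => X - C (ρ i)) l x y j) ''
        {q | q.1 ≤ tt n l q.2 - 2}) := by
  obtain ⟨L, hL⟩ := hl
  rw [(H.inv hL).regDiff_eq_span]
  exact span_laurentFamily_inv (e := fun j : Fin n => (tt n l j : ℤ) - 2)
    (neg_ne_zero.2 one_ne_zero) H.x_ne_zero fun j => H.kummerDiff_inv hL j

end IsKummerCover

end Inversion

section LaurentPolynomials

variable {k F : Type*} [Field k] [Field F] [Algebra k F] {n r : ℕ} {P : Fin r → k[X]}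
  {l : Fin r → ℕ} {x y : F}

theorem exists_pow_mul_mem_adjoin_singleton (hx : x ≠ 0) {a : F}
    (ha : a ∈ Algebra.adjoin k {x, x⁻¹}) : ∃ N : ℕ, x ^ N * a ∈ Algebra.adjoin k {x} := by
  have hmem := Algebra.self_mem_adjoin_singleton k x
  induction ha using Algebra.adjoin_induction with
  | mem a ha =>
    obtain rfl | rfl := ha
    · exact ⟨0, by simp⟩
    · exact ⟨1, by simp [hx]⟩
  | algebraMap c => exact ⟨0, by simp⟩
  | add a b _ _ ha hb =>
    obtain ⟨N, hN⟩ := ha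
    obtain ⟨M, hM⟩ := hb
    refine ⟨N + M, ?_⟩
    rw [mul_add, pow_add, mul_right_comm, mul_comm _ (x ^ M), mul_assoc (x ^ N)]
    exact add_mem (mul_mem (pow_mem hmem M) hN) (mul_mem (pow_mem hmem N) hM)
  | mul a b _ _ ha hb =>
    obtain ⟨N, hN⟩ := ha
    obtain ⟨M, hM⟩ := hb
    refine ⟨N + M, ?_⟩
    rw [pow_add, mul_mul_mul_comm]
    exact mul_mem hN hM

theorem exists_isIntegral_pow_mul {A B : Subalgebra k F} (hle : A ≤ B) (hx : x ≠ 0) (hxA : x ∈ A)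
    (hxB : x⁻¹ ∈ B) (hpow : ∀ a ∈ B, ∃ N : ℕ, x ^ N * a ∈ A) {b : F} (hb : IsIntegral B b) :
    ∃ N : ℕ, IsIntegral A (x ^ N * b) := by
  let : Algebra A B := (Subalgebra.inclusion hle).toAlgebra
  have : IsScalarTower A B F := .of_algebraMap_eq fun _ => rfl
  have : IsLocalization.Away (⟨x, hxA⟩ : A) B := by
    refine .mk _ ?_ (fun a => ?_) fun a a' haa' => ⟨0, ?_⟩
    · exact .of_mul_eq_one ⟨x⁻¹, hxB⟩ (Subtype.ext (mul_inv_cancel₀ hx))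
    · obtain ⟨N, hN⟩ := hpow a a.2
      exact ⟨N, ⟨_, hN⟩, Subtype.ext (mul_comm _ _)⟩
    · rw [Subalgebra.inclusion_injective hle haa']
  obtain ⟨⟨_, N, rfl⟩, hN⟩ :=
    IsIntegral.exists_multiple_integral_of_isLocalization (Rₘ := B) (.powers (⟨x, hxA⟩ : A)) b hb
  refine ⟨N, ?_⟩
  rwa [Submonoid.smul_def, Algebra.smul_def, map_pow] at hN

theorem exists_pow_mul_mem_regFun (hx : x ≠ 0) {b : F} (hb : b ∈ regFun k {x, x⁻¹}) :
    ∃ N : ℕ, x ^ N * b ∈ regFun k {x} :=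
  exists_isIntegral_pow_mul (Algebra.adjoin_mono (by simp)) hx
    (Algebra.self_mem_adjoin_singleton k x) (Algebra.subset_adjoin (by simp))
    (fun _ => exists_pow_mul_mem_adjoin_singleton hx) hb

namespace IsKummerCover

variable (H : IsKummerCover n P l x y)
include H

theorem zpow_mul_kummerFun_mem_regFun (m : ℤ) (μ : ℕ) :
    x ^ m * kummerFun n P l x y μ ∈ regFun k {x, x⁻¹} := by
  refine mul_mem ?_ (regFun_mono k (by simp) (H.kummerFun_mem_regFun μ))
  obtain ⟨m, rfl | rfl⟩ := m.eq_nat_or_neg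
  · rw [zpow_natCast]
    exact pow_mem (mem_regFun_of_mem (by simp)) m
  · rw [zpow_neg, zpow_natCast, ← inv_pow]
    exact pow_mem (mem_regFun_of_mem (by simp)) m

theorem regFun_pair_inv_eq_span : Subalgebra.toSubmodule (regFun k {x, x⁻¹}) =
    Submodule.span k (Set.range (laurentFamily x fun j : Fin n => kummerFun n P l x y j)) := by
  have hx := H.x_ne_zero
  apply le_antisymm
  · intro b hb
    obtain ⟨N, hN⟩ := exists_pow_mul_mem_regFun hx hb
    rw [← Subalgebra.mem_toSubmodule, H.regFun_eq_span] at hN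
    have hmap := Submodule.mem_map_of_mem (f := LinearMap.mulLeft k (x ^ N)⁻¹) hN
    rw [LinearMap.mulLeft_apply, inv_mul_cancel_left₀ (pow_ne_zero N hx),
      Submodule.map_span] at hmap
    refine Submodule.span_mono ?_ hmap
    rintro _ ⟨_, ⟨⟨m, j⟩, -, rfl⟩, rfl⟩
    refine ⟨(-N + m, j), ?_⟩
    rw [laurentFamily, laurentFamily, zpow_add₀ hx, zpow_neg, zpow_natCast, mul_smul]
    rfl
  · rw [Submodule.span_le]
    rintro _ ⟨⟨m, j⟩, rfl⟩
    exact H.zpow_mul_kummerFun_mem_regFun m j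

end IsKummerCover

end LaurentPolynomials

section ExactSequences

variable {k M M' M'' ι κ : Type*} [Field k] [AddCommGroup M] [Module k M] [AddCommGroup M']
  [Module k M'] [AddCommGroup M''] [Module k M''] {f : M' →ₗ[k] M} {g : M →ₗ[k] M''} {v : ι → M'}
  {w : κ → M}

theorem linearIndependent_sumElim_of_exact (hfg : Function.Exact f g) (hf : Function.Injective f)
    (hv : LinearIndependent k v) (hw : LinearIndependent k (g ∘ w)) :
    LinearIndependent k (Sum.elim w (f ∘ v)) := by
  refine (LinearIndependent.of_comp g hw).sum_type (hv.map' f (LinearMap.ker_eq_bot.2 hf)) ?_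
  refine (Submodule.range_ker_disjoint hw).mono_right ?_
  rw [LinearMap.exact_iff.1 hfg, Submodule.span_le]
  rintro _ ⟨i, rfl⟩
  exact LinearMap.mem_range_self f (v i)

theorem span_sumElim_eq_top_of_exact (hfg : Function.Exact f g)
    (hv : Submodule.span k (Set.range v) = ⊤)
    (hw : LinearMap.range g ≤ Submodule.span k (Set.range (g ∘ w))) :
    Submodule.span k (Set.range (Sum.elim w (f ∘ v))) = ⊤ := by
  have hspan : Submodule.span k (Set.range (Sum.elim w (f ∘ v))) =
      Submodule.span k (Set.range w) ⊔ LinearMap.ker g := by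
    rw [Set.Sum.elim_range, Submodule.span_union, Set.range_comp f, ← Submodule.map_span, hv,
      Submodule.map_top, ← LinearMap.exact_iff.1 hfg]
  rw [hspan, ← Submodule.comap_map_eq, Submodule.map_span, ← Set.range_comp, eq_top_iff]
  exact fun m _ => hw (LinearMap.mem_range_self g m)

end ExactSequences

/-! ### The de Rham sequence -/

section Cech

variable (k : Type*) {F : Type*} [Field k] [Field F] [Algebra k F] (x : F)

theorem mk_self_zero_mem_cocycles {ω : Ω[F⁄k]} (hω : ω ∈ Omega0 k x ⊓ OmegaInf k x) :
    (ω, ω, (0 : F)) ∈ cocycles k x :=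
  ⟨hω.1, hω.2, zero_mem _, by simp⟩

/-- The map `H⁰(X, Ω) → H¹_dR(X/k)` given by `ω ↦ (ω, ω, 0)`. -/
def globalDiffToH1dR : ↥(Omega0 k x ⊓ OmegaInf k x) →ₗ[k] H1dR k x :=
  ((coboundaries k x).submoduleOf (cocycles k x)).mkQ ∘ₗ
    { toFun := fun ω => ⟨(ω, ω, 0), mk_self_zero_mem_cocycles k x ω.2⟩
      map_add' := fun _ _ => by ext <;> simp
      map_smul' := fun _ _ => by ext <;> simp }

/-- The subspace `𝒪_X(U_0) + 𝒪_X(U_∞)` of the function field. -/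
def O0AddOinf : Submodule k F :=
  Subalgebra.toSubmodule (O0 k x) ⊔ Subalgebra.toSubmodule (Oinf k x)

/-- The map `H¹_dR(X/k) → H¹(X, 𝒪)` given by `(ω_0, ω_∞, f) ↦ f`. Its target is enlarged from
`𝒪(U_0 ∩ U_∞) / (𝒪(U_0) + 𝒪(U_∞))` to `F / (𝒪(U_0) + 𝒪(U_∞))`. -/
def H1dRToFunQuotient : H1dR k x →ₗ[k] F ⧸ O0AddOinf k x :=
  Submodule.mapQ _ _
    (LinearMap.snd k _ F ∘ₗ LinearMap.snd k _ _ ∘ₗ (cocycles k x).subtype) (by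
      rintro ⟨_, _⟩ ⟨f₀, hf₀, f₁, hf₁, rfl⟩
      exact sub_mem (Submodule.mem_sup_left hf₀) (Submodule.mem_sup_right hf₁))

variable {k x}

theorem cls_eq_cls_iff {w w' : Ω[F⁄k] × Ω[F⁄k] × F} {hw : w ∈ cocycles k x}
    {hw' : w' ∈ cocycles k x} : cls k x w hw = cls k x w' hw' ↔ w - w' ∈ coboundaries k x :=
  Submodule.Quotient.eq _

theorem exact_globalDiffToH1dR_H1dRToFunQuotient :
    Function.Exact (globalDiffToH1dR k x) (H1dRToFunQuotient k x) := by
  intro c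
  obtain ⟨⟨⟨ω₀, ω₁, f⟩, hw⟩, rfl⟩ := Submodule.Quotient.mk_surjective _ c
  refine Iff.trans (Submodule.Quotient.mk_eq_zero _) ⟨fun hf => ?_, ?_⟩
  · obtain ⟨f₀, hf₀, f₁, hf₁, rfl⟩ := Submodule.mem_sup.1 hf
    obtain ⟨hω₀, hω₁, -, hd⟩ := hw
    have heq : ω₀ - D k F f₀ = ω₁ + D k F f₁ := by
      rw [sub_eq_iff_eq_add, add_assoc, ← map_add, add_comm f₁, hd, add_sub_cancel]
    have hglobal : ω₀ - D k F f₀ ∈ Omega0 k x ⊓ OmegaInf k x :=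
      ⟨sub_mem hω₀ (D_mem_regDiff k hf₀), heq ▸ add_mem hω₁ (D_mem_regDiff k hf₁)⟩
    refine ⟨⟨_, hglobal⟩, cls_eq_cls_iff.2 ⟨-f₀, neg_mem (S := Subalgebra k F) hf₀, f₁, hf₁, ?_⟩⟩
    refine Prod.ext ?_ (Prod.ext ?_ ?_)
    · exact (sub_sub_cancel_left _ _).trans (map_neg _ _).symm
    · exact sub_eq_of_eq_add' heq
    · exact (zero_sub _).trans (neg_add' _ _)
  · rintro ⟨ω, hω⟩
    obtain ⟨f₀, hf₀, f₁, hf₁, hf⟩ := cls_eq_cls_iff.1 hω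
    have hsub : f = f₁ - f₀ := by
      rw [← neg_sub, ← neg_eq_iff_eq_neg, ← zero_sub]
      exact congrArg (fun w => w.2.2) hf
    change f ∈ _
    rw [hsub]
    exact sub_mem (Submodule.mem_sup_right hf₁) (Submodule.mem_sup_left hf₀)

theorem globalDiffToH1dR_injective
    (hD : ∀ f ∈ O0 k x ⊓ Oinf k x, D k F f = 0) : Function.Injective (globalDiffToH1dR k x) := by
  refine (injective_iff_map_eq_zero _).2 fun ω hω => ?_
  obtain ⟨f₀, hf₀, f₁, hf₁, hf⟩ := (Submodule.Quotient.mk_eq_zero _).1 hω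
  have heq : f₀ = f₁ := (sub_eq_zero.1 (congrArg (fun w => w.2.2) hf).symm)
  refine Subtype.ext ((congrArg Prod.fst hf).trans (hD f₀ ⟨hf₀, heq ▸ hf₁⟩))

theorem range_H1dRToFunQuotient_le : LinearMap.range (H1dRToFunQuotient k x) ≤
    (Subalgebra.toSubmodule (O0inf k x)).map (O0AddOinf k x).mkQ := by
  rintro _ ⟨c, rfl⟩
  obtain ⟨⟨w, hw⟩, rfl⟩ := Submodule.Quotient.mk_surjective _ c
  exact ⟨w.2.2, hw.2.2.1, rfl⟩

theorem exists_basis_H1dR {ι κ : Type*} {a : κ → Ω[F⁄k] × Ω[F⁄k] × F} {ω : ι → Ω[F⁄k]}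
    (hD : ∀ f ∈ O0 k x ⊓ Oinf k x, D k F f = 0) (hω : LinearIndependent k ω)
    (hspan : Submodule.span k (Set.range ω) = Omega0 k x ⊓ OmegaInf k x)
    (ha : ∀ j, a j ∈ cocycles k x)
    (hli : LinearIndependent k fun j => (O0AddOinf k x).mkQ (a j).2.2)
    (hsup : Subalgebra.toSubmodule (O0inf k x) ≤
      Submodule.span k (Set.range fun j => (a j).2.2) ⊔ O0AddOinf k x) :
    ∃ b : Module.Basis (κ ⊕ ι) k (H1dR k x), (∀ j, b (Sum.inl j) = cls k x _ (ha j)) ∧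
      ∀ i (hi : (ω i, ω i, (0 : F)) ∈ cocycles k x), b (Sum.inr i) = cls k x _ hi := by
  have hexact := exact_globalDiffToH1dR_H1dRToFunQuotient (k := k) (x := x)
  let v (i : ι) : ↥(Omega0 k x ⊓ OmegaInf k x) :=
    ⟨ω i, hspan ▸ Submodule.subset_span (Set.mem_range_self i)⟩
  have hvli : LinearIndependent k v := .of_comp (Submodule.subtype _) hω
  have hvspan : Submodule.span k (Set.range v) = ⊤ := by
    apply Submodule.map_injective_of_injective (Submodule.subtype_injective _)
    rw [Submodule.map_span, ← Set.range_comp, Submodule.map_subtype_top]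
    exact hspan
  let w (j : κ) : H1dR k x := cls k x (a j) (ha j)
  have hwli : LinearIndependent k (H1dRToFunQuotient k x ∘ w) := hli
  have hwspan : LinearMap.range (H1dRToFunQuotient k x) ≤
      Submodule.span k (Set.range (H1dRToFunQuotient k x ∘ w)) := by
    refine range_H1dRToFunQuotient_le.trans ((Submodule.map_mono hsup).trans ?_)
    rw [Submodule.map_sup, Submodule.mkQ_map_self, sup_bot_eq, Submodule.map_span, ← Set.range_comp]
    exact le_rfl
  refine ⟨.mk (linearIndependent_sumElim_of_exact hexact (globalDiffToH1dR_injective hD) hvli hwli)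
    (span_sumElim_eq_top_of_exact hexact hvspan hwspan).ge, fun j => ?_, fun i hi => ?_⟩
  · rw [Module.Basis.mk_apply, Sum.elim_inl]
  · rw [Module.Basis.mk_apply, Sum.elim_inr]
    rfl

end Cech

section Truncation

variable {k : Type*} [Field k]

theorem coeff_truncLE (h : k[X]) (m i : ℕ) :
    (truncLE h m).coeff i = if i ≤ m then h.coeff i else 0 := by
  simp only [truncLE, finsetSum_coeff, coeff_monomial, Finset.sum_ite_eq', Finset.mem_filter,
    mem_support_iff]
  split_ifs <;> grind

theorem coeff_truncGT (h : k[X]) (m i : ℕ) :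
    (truncGT h m).coeff i = if m < i then h.coeff i else 0 := by
  simp only [truncGT, finsetSum_coeff, coeff_monomial, Finset.sum_ite_eq', Finset.mem_filter,
    mem_support_iff]
  split_ifs <;> grind

theorem truncLE_add_truncGT (h : k[X]) (m : ℕ) : truncLE h m + truncGT h m = h := by
  ext i
  rw [coeff_add, coeff_truncLE, coeff_truncGT]
  split_ifs <;> grind

theorem le_of_mem_support_truncLE {h : k[X]} {m i : ℕ} (hi : i ∈ (truncLE h m).support) :
    i ≤ m := by
  by_contra hlt
  exact mem_support_iff.1 hi (by rw [coeff_truncLE, if_neg hlt])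

theorem lt_of_mem_support_truncGT {h : k[X]} {m i : ℕ} (hi : i ∈ (truncGT h m).support) :
    m < i := by
  by_contra hle
  exact mem_support_iff.1 hi (by rw [coeff_truncGT, if_neg hle])

end Truncation

section IndexSets

variable {n r : ℕ} (l : Fin r → ℕ)

/-- The index of the function `x ^ (-ν) w_μ`, the third entry of `aTriple`, in the family
`laurentFamily` of the functions `x ^ m w_j`. -/
def funIdx (q : Idx n l) : ℤ × Fin n := (-q.1.2, ⟨q.1.1, q.2.1.2⟩)

/-- The index of the differential `x ^ (ν - 1) w_μ⁻¹ dx` of `deltaTriple` in the family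
`laurentFamily` of the differentials `x ^ m w_j⁻¹ dx`. -/
def diffIdx (q : Idx n l) : ℤ × Fin n := (q.1.2 - 1, ⟨q.1.1, q.2.1.2⟩)

theorem funIdx_injective : Function.Injective (funIdx (n := n) l) := by
  intro q q' h
  simp only [funIdx, Prod.mk.injEq, Fin.mk.injEq, neg_inj, Nat.cast_inj] at h
  exact Subtype.ext (Prod.ext h.2 h.1)

theorem diffIdx_injective : Function.Injective (diffIdx (n := n) l) := by
  intro q q' h
  simp only [diffIdx, Prod.mk.injEq, Fin.mk.injEq, sub_left_inj, Nat.cast_inj] at h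
  exact Subtype.ext (Prod.ext h.2 h.1)

variable {l} in
theorem ne_zero_of_tt_ne_zero {μ : ℕ} (h : tt n l μ ≠ 0) : μ ≠ 0 := by
  rintro rfl
  exact h (tt_zero l)

theorem range_funIdx : Set.range (funIdx (n := n) l) =
    ({q : ℤ × Fin n | q.1 ≤ -tt n l q.2} ∪ {q | 0 ≤ q.1})ᶜ := by
  ext ⟨m, j, hj⟩
  simp only [Set.mem_range, Set.mem_compl_iff, Set.mem_union, Set.mem_ofPred_eq, not_or, not_le]
  constructor
  · rintro ⟨⟨⟨μ, ν⟩, hμ, ht, hν⟩, h⟩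
    simp only [funIdx, Prod.mk.injEq, Fin.mk.injEq] at h hμ ht hν
    obtain ⟨rfl, rfl⟩ := h
    lia
  · rintro ⟨hlt, hneg⟩
    have hj0 : j ≠ 0 := ne_zero_of_tt_ne_zero (n := n) (l := l) (by lia)
    refine ⟨⟨⟨j, m.natAbs⟩, ?_⟩, Prod.ext ?_ rfl⟩ <;> simp only [funIdx] <;> lia

theorem range_diffIdx : Set.range (diffIdx (n := n) l) =
    {q : ℤ × Fin n | q.1 ≤ tt n l q.2 - 2} ∩ {q | 0 ≤ q.1} := by
  ext ⟨m, j, hj⟩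
  simp only [Set.mem_range, Set.mem_inter_iff, Set.mem_ofPred_eq]
  constructor
  · rintro ⟨⟨⟨μ, ν⟩, hμ, ht, hν⟩, h⟩
    simp only [diffIdx, Prod.mk.injEq, Fin.mk.injEq] at h hμ ht hν
    obtain ⟨rfl, rfl⟩ := h
    lia
  · rintro ⟨hle, hnonneg⟩
    have hj0 : j ≠ 0 := ne_zero_of_tt_ne_zero (n := n) (l := l) (by lia)
    refine ⟨⟨⟨j, m.natAbs + 1⟩, ?_⟩, Prod.ext ?_ rfl⟩ <;> simp only [diffIdx] <;> lia

end IndexSets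

section IndependentFamilies

variable {R M ι : Type*} [Ring R] [AddCommGroup M] [Module R M] {v : ι → M}

theorem span_image_inf_span_image (hv : LinearIndependent R v) (S T : Set ι) :
    Submodule.span R (v '' S) ⊓ Submodule.span R (v '' T) = Submodule.span R (v '' (S ∩ T)) := by
  simp only [Finsupp.span_image_eq_map_linearCombination, Finsupp.supported_inter]
  exact (Submodule.map_inf _ hv).symm

theorem linearIndependent_mkQ_comp (hv : LinearIndependent R v) {κ : Type*}
    {p : κ → ι} (hp : Function.Injective p) {S : Set ι} (hS : Disjoint (Set.range p) S) :
    LinearIndependent R ((Submodule.span R (v '' S)).mkQ ∘ v ∘ p) := by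
  refine (hv.comp p hp).map ?_
  rw [Submodule.ker_mkQ, Set.range_comp]
  exact hv.disjoint_span_image hS

end IndependentFamilies

/-! ### The explicit triples as cocycles -/

section Classes

variable {k F : Type*} [Field k] [Field F] [Algebra k F] {n r : ℕ} {ρ : Fin r → k}
  {l : Fin r → ℕ} {x y : F}

theorem aTriple_snd_snd (μ ν s : ℕ) : (aTriple n ρ l x y μ ν s).2.2 =
    x ^ (-ν : ℤ) * kummerFun n (fun i => X - C (ρ i)) l x y μ := by
  rw [zpow_neg, zpow_natCast, inv_mul_eq_div, kummerFun, div_div, mul_comm _ (x ^ ν)]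
  rfl

theorem omegaOne_eq_kummerDiff (μ : ℕ) :
    omegaOne n ρ l x y μ = kummerDiff n (fun i => X - C (ρ i)) l x y μ := by
  rw [kummerDiff, kummerFun, inv_div]
  rfl

theorem deltaTriple_fst_eq_comp :
    (fun q : Idx n l => (deltaTriple n ρ l x y q.1.1 q.1.2).1) =
      laurentFamily x (fun j : Fin n => kummerDiff n (fun i => X - C (ρ i)) l x y j) ∘
        diffIdx l := by
  funext q
  have hν : (q.1.2 - 1 : ℤ) = (q.1.2 - 1 : ℕ) := (Nat.cast_pred q.2.2.2.1).symm
  rw [Function.comp_apply, laurentFamily, diffIdx, hν, zpow_natCast, deltaTriple,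
    omegaOne_eq_kummerDiff]

theorem psi_eq (μ ν : ℕ) : psi n ρ l μ ν = X * dlogPoly n (fun i => X - C (ρ i)) l μ -
    C ((ν * n : ℕ) : k) * ramPoly n (fun i => X - C (ρ i)) l μ := by
  simp only [psi, dlogPoly, ramPoly, derivative_X_sub_C, Finset.mul_sum]
  congr 1
  exact Finset.sum_congr rfl fun i _ => by ring

namespace IsKummerCover

variable (H : IsKummerCover n (fun i => X - C (ρ i)) l x y)
include H

theorem D_zpow_neg_mul_kummerFun {μ κ : ℕ} (h : n ∣ μ + κ) (ν : ℕ) :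
    D k F (x ^ (-ν : ℤ) * kummerFun n (fun i => X - C (ρ i)) l x y μ) =
      (aeval x (psi n ρ l μ ν) / (n * x ^ (ν + 1))) • omegaOne n ρ l x y κ := by
  have hn := H.natCast_functionField_ne_zero
  have hx := H.x_ne_zero
  rw [H.D_zpow_mul_kummerFun h, omegaOne_eq_kummerDiff, psi_eq, zpow_sub₀ hx, zpow_neg,
    zpow_natCast, zpow_one]
  congr 1
  simp only [map_sub, map_mul, aeval_X, map_natCast]
  push_cast
  field_simp
  ring

theorem div_smul_omegaOne_mem_span {p : k[X]} {j ν : ℕ} (hj : j < n) {S : Set (ℤ × Fin n)}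
    (hS : ∀ i ∈ p.support, ((i : ℤ) - ν - 1, ⟨j, hj⟩) ∈ S) :
    (aeval x p / (n * x ^ (ν + 1))) • omegaOne n ρ l x y j ∈ Submodule.span k
      (laurentFamily x (fun j : Fin n => kummerDiff n (fun i => X - C (ρ i)) l x y j) '' S) := by
  have hcoef : aeval x p / (n * x ^ (ν + 1)) =
      (n : k)⁻¹ • (x ^ (-ν - 1 : ℤ) * aeval x p) := by
    rw [← neg_add', zpow_neg, ← Nat.cast_add_one, zpow_natCast, Algebra.smul_def, map_inv₀,
      map_natCast, div_eq_mul_inv, mul_inv]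
    ring
  rw [hcoef, omegaOne_eq_kummerDiff, smul_assoc]
  refine Submodule.smul_mem _ _ (zpow_mul_aeval_smul_mem_span (j := (⟨j, hj⟩ : Fin n))
    (v := fun j : Fin n => kummerDiff n (fun i => X - C (ρ i)) l x y j) H.x_ne_zero fun i hi => ?_)
  convert hS i hi using 2
  ring

theorem aTriple_mem_cocycles (hl : n ∣ ∑ i, l i) {μ ν s : ℕ} (hμ : 0 < μ) (hμn : μ ≤ n)
    (hνs : ν ≤ s) (hsν : s < ν + tt n l (n - μ)) : aTriple n ρ l x y μ ν s ∈ cocycles k x := by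
  have := H.neZero
  have hdvd : n ∣ μ + (n - μ) := by rw [Nat.add_sub_cancel' hμn]
  have hlt : n - μ < n := Nat.sub_lt (NeZero.pos n) hμ
  refine ⟨?_, neg_mem ?_, ?_, ?_⟩
  · rw [Omega0, H.regDiff_inv_eq_span hl]
    refine H.div_smul_omegaOne_mem_span hlt fun i hi => ?_
    have := le_of_mem_support_truncLE hi
    simp only [Set.mem_ofPred_eq]
    lia
  · rw [OmegaInf, H.regDiff_eq_span]
    refine H.div_smul_omegaOne_mem_span hlt fun i hi => ?_
    have := lt_of_mem_support_truncGT hi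
    simp only [Set.mem_ofPred_eq]
    lia
  · rw [aTriple_snd_snd]
    exact H.zpow_mul_kummerFun_mem_regFun _ _
  · rw [aTriple_snd_snd, H.D_zpow_neg_mul_kummerFun hdvd, aTriple, sub_neg_eq_add, ← add_smul,
      ← add_div, ← map_add, truncLE_add_truncGT]

theorem D_kummerFun_eq_zero (hl : n ∣ ∑ i, l i) {μ : ℕ} (hμ : tt n l μ = 0) :
    D k F (kummerFun n (fun i => X - C (ρ i)) l x y μ) = 0 := by
  have := H.neZero
  obtain ⟨ν, hν⟩ := exists_dvd_add (n := n) μ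
  have hzero : ∀ i, numPts n l i * rem n l μ i = 0 := by
    have hsum := mul_tt n l hl μ
    rw [hμ, mul_zero, eq_comm, Finset.sum_eq_zero_iff] at hsum
    exact fun i => hsum i (Finset.mem_univ i)
  rw [H.D_kummerFun hν]
  simp [dlogPoly, hzero]

theorem O0_inf_Oinf_eq_span (hl : n ∣ ∑ i, l i) : Subalgebra.toSubmodule (O0 k x ⊓ Oinf k x) =
    Submodule.span k (laurentFamily x
      (fun j : Fin n => kummerFun n (fun i => X - C (ρ i)) l x y j) ''
        ({q | q.1 ≤ -tt n l q.2} ∩ {q | 0 ≤ q.1})) := by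
  rw [← span_image_inf_span_image
    (linearIndependent_laurentFamily H.transcendental H.linearIndependent_kummerFun),
    ← H.regFun_inv_eq_span hl, ← H.regFun_eq_span]
  rfl

theorem O0AddOinf_eq_span (hl : n ∣ ∑ i, l i) : O0AddOinf k x =
    Submodule.span k (laurentFamily x
      (fun j : Fin n => kummerFun n (fun i => X - C (ρ i)) l x y j) ''
        ({q | q.1 ≤ -tt n l q.2} ∪ {q | 0 ≤ q.1})) := by
  rw [Set.image_union, Submodule.span_union, ← H.regFun_inv_eq_span hl, ← H.regFun_eq_span]
  rfl

theorem Omega0_inf_OmegaInf_eq_span (hl : n ∣ ∑ i, l i) : Omega0 k x ⊓ OmegaInf k x =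
    Submodule.span k (laurentFamily x
      (fun j : Fin n => kummerDiff n (fun i => X - C (ρ i)) l x y j) ''
        ({q | q.1 ≤ tt n l q.2 - 2} ∩ {q | 0 ≤ q.1})) := by
  rw [← span_image_inf_span_image
    (linearIndependent_laurentFamily H.transcendental H.linearIndependent_kummerDiff),
    ← H.regDiff_inv_eq_span hl, ← H.regDiff_eq_span, Omega0, OmegaInf]

theorem D_eq_zero_of_mem_O0_inf_Oinf (hl : n ∣ ∑ i, l i) {f : F} (hf : f ∈ O0 k x ⊓ Oinf k x) :
    D k F f = 0 := by
  rw [← Subalgebra.mem_toSubmodule, H.O0_inf_Oinf_eq_span hl] at hf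
  suffices h : Submodule.span k _ ≤ LinearMap.ker (D k F).toLinearMap from h hf
  rw [Submodule.span_le]
  rintro _ ⟨⟨m, j⟩, ⟨hle, hnonneg⟩, rfl⟩
  simp only [Set.mem_ofPred_eq] at hle hnonneg
  obtain ⟨rfl, ht⟩ : m = 0 ∧ tt n l j = 0 := by lia
  simpa [laurentFamily] using H.D_kummerFun_eq_zero hl ht

theorem linearIndependent_mkQ_aTriple (hl : n ∣ ∑ i, l i) (s : Idx n l → ℕ) :
    LinearIndependent k fun q : Idx n l =>
      (O0AddOinf k x).mkQ (aTriple n ρ l x y q.1.1 q.1.2 (s q)).2.2 := by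
  rw [H.O0AddOinf_eq_span hl]
  simp only [aTriple_snd_snd]
  exact linearIndependent_mkQ_comp
    (linearIndependent_laurentFamily H.transcendental H.linearIndependent_kummerFun)
    (funIdx_injective l) (range_funIdx l ▸ disjoint_compl_left)

theorem O0inf_le_span_aTriple_sup (hl : n ∣ ∑ i, l i) (s : Idx n l → ℕ) :
    Subalgebra.toSubmodule (O0inf k x) ≤
      Submodule.span k (Set.range fun q : Idx n l => (aTriple n ρ l x y q.1.1 q.1.2 (s q)).2.2) ⊔
        O0AddOinf k x := by
  have hrange : (Set.range fun q : Idx n l => (aTriple n ρ l x y q.1.1 q.1.2 (s q)).2.2) =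
      laurentFamily x (fun j : Fin n => kummerFun n (fun i => X - C (ρ i)) l x y j) ''
        Set.range (funIdx l) := by
    simp only [aTriple_snd_snd, ← Set.range_comp]
    rfl
  rw [hrange, H.O0AddOinf_eq_span hl, ← Submodule.span_union, ← Set.image_union, range_funIdx,
    Set.compl_union_self, Set.image_univ]
  exact H.regFun_pair_inv_eq_span.le

theorem linearIndependent_deltaTriple :
    LinearIndependent k fun q : Idx n l => (deltaTriple n ρ l x y q.1.1 q.1.2).1 := by
  rw [deltaTriple_fst_eq_comp]
  exact (linearIndependent_laurentFamily H.transcendental H.linearIndependent_kummerDiff).comp _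
    (diffIdx_injective l)

theorem span_deltaTriple (hl : n ∣ ∑ i, l i) :
    Submodule.span k (Set.range fun q : Idx n l => (deltaTriple n ρ l x y q.1.1 q.1.2).1) =
      Omega0 k x ⊓ OmegaInf k x := by
  rw [deltaTriple_fst_eq_comp, Set.range_comp, range_diffIdx, H.Omega0_inf_OmegaInf_eq_span hl]

theorem exists_basis_cls (hl : n ∣ ∑ i, l i) {s : Idx n l → ℕ}
    (hνs : ∀ q, q.1.2 ≤ s q) (hsν : ∀ q, s q < q.1.2 + tt n l (n - q.1.1)) :
    ∃ (ha : ∀ q : Idx n l, aTriple n ρ l x y q.1.1 q.1.2 (s q) ∈ cocycles k x)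
      (hδ : ∀ q : Idx n l, deltaTriple n ρ l x y q.1.1 q.1.2 ∈ cocycles k x)
      (b : Module.Basis (Idx n l ⊕ Idx n l) k (H1dR k x)),
      (∀ q, b (Sum.inl q) = cls k x _ (ha q)) ∧ ∀ q, b (Sum.inr q) = cls k x _ (hδ q) := by
  have ha (q : Idx n l) : aTriple n ρ l x y q.1.1 q.1.2 (s q) ∈ cocycles k x :=
    H.aTriple_mem_cocycles hl q.2.1.1 q.2.1.2.le (hνs q) (hsν q)
  have hδ (q : Idx n l) : deltaTriple n ρ l x y q.1.1 q.1.2 ∈ cocycles k x :=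
    mk_self_zero_mem_cocycles k x <| (H.span_deltaTriple hl).le <| Submodule.subset_span ⟨q, rfl⟩
  obtain ⟨b, hb, hb'⟩ := exists_basis_H1dR (fun f => H.D_eq_zero_of_mem_O0_inf_Oinf hl)
    H.linearIndependent_deltaTriple (H.span_deltaTriple hl) ha
    (H.linearIndependent_mkQ_aTriple hl s) (H.O0inf_le_span_aTriple_sup hl s)
  exact ⟨ha, hδ, b, hb, fun q => hb' q (hδ q)⟩

end IsKummerCover

end Classes

section RationalFunctionField

variable {k F : Type*} [Field k] [Field F] [Algebra k F] [Algebra (RatFunc k) F]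
  [IsScalarTower k (RatFunc k) F]

theorem transcendental_algebraMap_ratFuncX :
    Transcendental k (algebraMap (RatFunc k) F RatFunc.X) :=
  (transcendental_algebraMap_iff (algebraMap (RatFunc k) F).injective).2 RatFunc.transcendental_X

theorem adjoin_algebraMap_ratFuncX :
    k⟮algebraMap (RatFunc k) F RatFunc.X⟯ =
      (IsScalarTower.toAlgHom k (RatFunc k) F).fieldRange := by
  rw [AlgHom.fieldRange_eq_map, ← RatFunc.adjoin_X, IntermediateField.adjoin_map,
    Set.image_singleton, IsScalarTower.coe_toAlgHom']

theorem finrank_adjoin_algebraMap_ratFuncX :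
    Module.finrank k⟮algebraMap (RatFunc k) F RatFunc.X⟯ F = Module.finrank (RatFunc k) F := by
  rw [adjoin_algebraMap_ratFuncX]
  exact (Algebra.finrank_eq_of_equiv_equiv
    (AlgEquiv.ofInjectiveField (IsScalarTower.toAlgHom k (RatFunc k) F)).toRingEquiv
    (RingEquiv.refl F) rfl).symm

theorem adjoin_algebraMap_ratFuncX_insert {y : F}
    (hy : IntermediateField.adjoin (RatFunc k) {y} = ⊤) :
    k⟮algebraMap (RatFunc k) F RatFunc.X, y⟯ = ⊤ := by
  set L := k⟮algebraMap (RatFunc k) F RatFunc.X, y⟯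
  have hL (q : RatFunc k) : algebraMap (RatFunc k) F q ∈ L := by
    have hq : algebraMap (RatFunc k) F q ∈ k⟮algebraMap (RatFunc k) F RatFunc.X⟯ := by
      rw [adjoin_algebraMap_ratFuncX]
      exact ⟨q, rfl⟩
    exact IntermediateField.adjoin.mono k _ _ (by simp) hq
  have htop : (RatFunc k)⟮y⟯ ≤ L.toSubfield.toIntermediateField hL :=
    IntermediateField.adjoin_simple_le_iff.2 (IntermediateField.subset_adjoin k _ (by simp))
  exact eq_top_iff.2 fun z _ => htop (hy ▸ IntermediateField.mem_top)

theorem isKummerCover_of_ratFunc {n r : ℕ} (hn : (n : k) ≠ 0) {ρ : Fin r → k}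
    (hρ : Function.Injective ρ) {l : Fin r → ℕ} {y : F}
    (hy : y ^ n = aeval (algebraMap (RatFunc k) F RatFunc.X) (ff ρ l))
    (hgen : IntermediateField.adjoin (RatFunc k) {y} = ⊤)
    (hdeg : Module.finrank (RatFunc k) F = n) :
    IsKummerCover n (fun i => X - C (ρ i)) l (algebraMap (RatFunc k) F RatFunc.X) y where
  natCast_ne_zero := hn
  separable _ := separable_X_sub_C
  pairwise_isCoprime := pairwise_coprime_X_sub_C hρ
  transcendental := transcendental_algebraMap_ratFuncX
  pow_eq := hy
  adjoin_eq_top := adjoin_algebraMap_ratFuncX_insert hgen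
  finrank_eq := finrank_adjoin_algebraMap_ratFuncX.trans hdeg

end RationalFunctionField

end KummerCover

end

theorem mainTheorem1_general {k : Type*} [Field k]
    (n : ℕ) (hn : (n : k) ≠ 0)
    (r : ℕ) (ρ : Fin r → k) (hρ : Function.Injective ρ)
    (l : Fin r → ℕ) (hl : n ∣ ∑ i, l i)
    {F : Type*} [Field F] [Algebra k F] [Algebra (RatFunc k) F] [IsScalarTower k (RatFunc k) F]
    (x y : F) (hx : x = algebraMap (RatFunc k) F RatFunc.X)
    (hy : y ^ n = Polynomial.aeval x (KummerCover.ff ρ l))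
    (hgen : IntermediateField.adjoin (RatFunc k) {y} = ⊤)
    (hdeg : Module.finrank (RatFunc k) F = n)
    (s : KummerCover.Idx n l → ℕ)
    (hs : ∀ q, s q = q.1.2 ∨ (s q = q.1.2 + 1 ∧ 2 ≤ KummerCover.tt n l (n - q.1.1))) :
    ∃ (ha : ∀ q : KummerCover.Idx n l,
        KummerCover.aTriple n ρ l x y q.1.1 q.1.2 (s q) ∈ KummerCover.cocycles k x)
      (hδ : ∀ q : KummerCover.Idx n l,
        KummerCover.deltaTriple n ρ l x y q.1.1 q.1.2 ∈ KummerCover.cocycles k x)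
      (b : Module.Basis (KummerCover.Idx n l ⊕ KummerCover.Idx n l) k (KummerCover.H1dR k x)),
      (∀ q, b (Sum.inl q) = KummerCover.cls k x _ (ha q)) ∧
      (∀ q, b (Sum.inr q) = KummerCover.cls k x _ (hδ q)) := by
  subst hx
  have H := KummerCover.isKummerCover_of_ratFunc hn hρ hy hgen hdeg
  have := H.neZero
  have htt (q : KummerCover.Idx n l) : KummerCover.tt n l (n - q.1.1) ≠ 0 := by
    have hdvd : n ∣ q.1.1 + (n - q.1.1) := by rw [Nat.add_sub_cancel' q.2.1.2.le]
    exact KummerCover.tt_ne_zero_of_dvd l hdvd hl (by have := q.2.2.1; lia)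
  refine H.exists_basis_cls hl (fun q => ?_) fun q => ?_
  · rcases hs q with h | h <;> lia
  · have := htt q
    rcases hs q with h | h <;> lia

theorem mainTheorem1 {k : Type*} [Field k] [IsAlgClosed k]
    (n : ℕ) (hn : (n : k) ≠ 0)
    (r : ℕ) (ρ : Fin r → k) (hρ : Function.Injective ρ)
    (l : Fin r → ℕ) (hl : n ∣ ∑ i, l i)
    {F : Type*} [Field F] [Algebra k F] [Algebra (RatFunc k) F] [IsScalarTower k (RatFunc k) F]
    (x y : F) (hx : x = algebraMap (RatFunc k) F RatFunc.X)
    (hy : y ^ n = Polynomial.aeval x (KummerCover.ff ρ l))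
    (hgen : IntermediateField.adjoin (RatFunc k) {y} = ⊤)
    (hdeg : Module.finrank (RatFunc k) F = n)
    (s : KummerCover.Idx n l → ℕ)
    (hs : ∀ q, s q = q.1.2 ∨ (s q = q.1.2 + 1 ∧ 2 ≤ KummerCover.tt n l (n - q.1.1))) :
    ∃ (ha : ∀ q : KummerCover.Idx n l,
        KummerCover.aTriple n ρ l x y q.1.1 q.1.2 (s q) ∈ KummerCover.cocycles k x)
      (hδ : ∀ q : KummerCover.Idx n l,
        KummerCover.deltaTriple n ρ l x y q.1.1 q.1.2 ∈ KummerCover.cocycles k x)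
      (b : Module.Basis (KummerCover.Idx n l ⊕ KummerCover.Idx n l) k (KummerCover.H1dR k x)),
      (∀ q, b (Sum.inl q) = KummerCover.cls k x _ (ha q)) ∧
      (∀ q, b (Sum.inr q) = KummerCover.cls k x _ (hδ q)) :=
  mainTheorem1_general n hn r ρ hρ l hl x y hx hy hgen hdeg s hs
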